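/- Let $k\in\mathbb N$ and let $\mathbb S_k=\mathbb Z^2\times\{0,\dots,k\}$ be the slab, whose edge set $E$ consists of the pairs of vertices at Euclidean distance $1$. Let $\omega=(\omega(e))_{e\in E}$ be i.i.d. uniform $[0,1]$ labels with law $\mathbb P$, and let $p_c=p_c(\mathbb S_k)$ be the critical probability of Bernoulli bond percolation on $\mathbb S_k$. An edge $e$ is $p_c$-open if $\omega(e)<p_c$ and $p_c$-closed otherwise. Write $\bar B_n=[-n,n]^2\times\{0,\dots,k\}$, where $[-n,n]\subset\mathbb Z$, and let $\partial\bar B_n$ be the set of vertices of $\bar B_n$ with a neighbour in $\mathbb S_k\setminus\bar B_n$. For $a<b$ let $C_{a,b}$ be the event that there is a $p_c$-open circuit in $\bar B_b\setminus\bar B_a$ that surrounds the origin (a simple cycle whose projection to $\mathbb Z^2$ has nonzero winding number around $0$). Let $D_{a,b}$ be the event that there is a $p_c$-closed dual surface in $\bar B_b\setminus\bar B_a$ that surrounds the origin, i.e. a set of plaquettes dual to $p_c$-closed edges, each edge with both endpoints in $\bar B_b$ but not both in $\bar B_a$, such that every path from $\bar B_a$ to $\partial\bar B_b$ crosses one of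 the plaquettes. Order vertices by Euclidean norm and, for equal norms, lexicographically by coordinates. Represent each circuit by the closed path that starts at its smallest vertex and whose second vertex is smaller than its last but one, and order circuits lexicographically through these representatives. For a vertex $x$, the invasion cluster of $x$ is the increasing union of the subgraphs $\mathcal I_x(j)$, where $\mathcal I_x(0)=\{x\}$ and $\mathcal I_x(j+1)$ is $\mathcal I_x(j)$ together with the edge (and its endpoints) of lowest label among the edges not in $\mathcal I_x(j)$ but incident to a vertex of $\mathcal I_x(j)$. For $x\in\bar B_n$ let $\mathcal I_x^{n}$ be the invasion cluster of $x$ stopped when it first reaches a vertex of $\partial\bar B_n$. Let $c_0>0$ and let $(n_i)_{i\ge 0}$, $(m_i)_{i\ge 0}$ be sequences of non-negative integers such that for every $i$: $2n_i<m_i<n_{i+1}$, $\mathbb P[C_{n_i,2n_i}]\ge c_0$ and $\mathbb P[D_{2n_i,m_i}]\ge 1-c_0/2$. On $C_{n_i,2n_i}$ let $\Gamma^{(i)}_{\min}$ be the minimal $p_c$-open circuit in $\bar B_{2n_i}\setminus\bar B_{n_i}$ that surrounds the origin, and let $\mathcal B_x^{m_i}$ be the event that $C_{n_i,2n_i}$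 occurs and $\Gamma^{(i)}_{\min}\subset\mathcal I_x^{m_i}$ (as subgraphs). For a Borel set $A\subset[0,1]^{\bar B_{m_{i-1}}}$, seen as an event that depends only on the labels of the edges with both endpoints in $\bar B_{m_{i-1}}$, put $\mathcal Y_A^i=C_{n_i,2n_i}\cap D_{2n_i,m_i}\cap A$. **Lemma (gluing lemma for invasion).** There are constants $C_1,C_2,C_3<\infty$ and $c_2>0$ that depend only on $k$, and a constant $c_1>0$ that depends only on $k$ and $c_0$, such that for all sequences as above, every $x\in\mathbb S_k$, every $i_0$ with $x\in\bar B_{m_{i_0}}$, every $i>i_0$ and every Borel set $A\subset[0,1]^{\bar B_{m_{i-1}}}$, \begin{align*} \mathbb P[(\mathcal B_0^{m_i})^c,\ \mathcal B_x^{m_i},\ \mathcal Y_A^i]&\le C_1\,\mathbb P[\mathcal B_0^{m_i},\mathcal B_x^{m_i},\mathcal Y_A^i],\\ \mathbb P[\mathcal B_0^{m_i},\ (\mathcal B_x^{m_i})^c,\ \mathcal Y_A^i]&\le C_2\,\mathbb P[\mathcal B_0^{m_i},\mathcal B_x^{m_i},\mathcal Y_A^i],\\ \mathbb P[(\mathcal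 B_0^{m_i})^c,\ (\mathcal B_x^{m_i})^c,\ \mathcal Y_A^i]&\le C_3\,\mathbb P[\mathcal B_0^{m_i},\mathcal B_x^{m_i},\mathcal Y_A^i], \end{align*} and consequently $$\mathbb P[\mathcal B_0^{m_i},\mathcal B_x^{m_i},\mathcal Y_A^i]\ \ge\ c_2\,\mathbb P[\mathcal Y_A^i]\ \ge\ c_1\,\mathbb P[A].$$ -/

import Mathlib

open MeasureTheory

namespace SlabInvasion

/-- Vertices of the slab `ℤ² × {0, …, k}`. -/
abbrev Vertex (k : ℕ) : Type := ℤ × ℤ × Fin (k + 1)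

/-- The slab graph: the edges are the pairs of vertices at Euclidean distance `1`. -/
def slab (k : ℕ) : SimpleGraph (Vertex k) where
  Adj x y := (x.1 - y.1) ^ 2 + (x.2.1 - y.2.1) ^ 2
    + (((x.2.2 : ℕ) : ℤ) - ((y.2.2 : ℕ) : ℤ)) ^ 2 = 1
  symm := ⟨fun x y h => by rw [← h]; ring⟩
  loopless := ⟨fun x h => by simp at h⟩

/-- The edge set of the slab, as a type. -/
abbrev Edge (k : ℕ) : Type := (slab k).edgeSet

/-- Configurations: a label in `[0, 1]` for every edge. -/
abbrev Config (k : ℕ) : Type := Edge k → unitInterval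

/-- The law of i.i.d. uniform labels. -/
noncomputable def prob (k : ℕ) : Measure (Config k) :=
  Measure.infinitePi fun _ : Edge k => (volume : Measure unitInterval)

/-- An edge is `p`-open if its label is smaller than `p`; otherwise it is `p`-closed. -/
def IsOpenEdge {k : ℕ} (p : ℝ) (ω : Config k) (e : Edge k) : Prop := (ω e : ℝ) < p

/-- The graph formed by the `p`-open edges. -/
def openGraph {k : ℕ} (p : ℝ) (ω : Config k) : SimpleGraph (Vertex k) where
  Adj x y := ∃ h : (slab k).Adj x y, IsOpenEdge p ω ⟨s(x, y), h⟩
  symm := ⟨by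
    rintro x y ⟨h, ho⟩
    refine ⟨h.symm, ?_⟩
    have he : (⟨s(y, x), h.symm⟩ : Edge k) = ⟨s(x, y), h⟩ := Subtype.ext Sym2.eq_swap
    rw [he]; exact ho⟩
  loopless := ⟨fun x ⟨h, _⟩ => (slab k).loopless.irrefl x h⟩

/-- The `p`-open cluster of a vertex. -/
def cluster {k : ℕ} (p : ℝ) (ω : Config k) (v : Vertex k) : Set (Vertex k) :=
  {w | (openGraph p ω).Reachable v w}

/-- The critical probability of Bernoulli bond percolation on the slab: the supremum of the
densities `p` for which there is almost surely no infinite `p`-open cluster. -/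
noncomputable def pc (k : ℕ) : ℝ :=
  sSup {p : ℝ | 0 ≤ p ∧ p ≤ 1 ∧ prob k {ω | ∃ v, (cluster p ω v).Infinite} = 0}

/-- The cylinder `[-n, n]² × {0, …, k}`. -/
def box (k n : ℕ) : Set (Vertex k) := {x | |x.1| ≤ (n : ℤ) ∧ |x.2.1| ≤ (n : ℤ)}

/-- The vertex boundary: the vertices of `U` that have a neighbour outside `U`. -/
def vertexBoundary {k : ℕ} (U : Set (Vertex k)) : Set (Vertex k) :=
  {u | u ∈ U ∧ ∃ w, w ∉ U ∧ (slab k).Adj u w}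

/-- The edges with both endpoints in `U`. -/
def edgesIn {k : ℕ} (U : Set (Vertex k)) : Set (Edge k) := {e | ∀ u ∈ e.1, u ∈ U}

/-- The event of all configurations whose restriction to the edges inside `U` belongs to `A`. -/
def cylinderEvent {k : ℕ} {U : Set (Vertex k)} (A : Set (edgesIn U → unitInterval)) :
    Set (Config k) :=
  {ω | (fun e : edgesIn U => ω e.1) ∈ A}

/-! ### Circuits -/

/-- Square of the Euclidean norm. -/
def normSq {k : ℕ} (x : Vertex k) : ℤ := x.1 ^ 2 + x.2.1 ^ 2 + ((x.2.2 : ℕ) : ℤ) ^ 2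

/-- The ordering of the vertices: by Euclidean norm, and lexicographically by coordinates
among vertices with the same norm. -/
def vertexLT {k : ℕ} (x y : Vertex k) : Prop :=
  normSq x < normSq y ∨ (normSq x = normSq y ∧
    (x.1 < y.1 ∨ (x.1 = y.1 ∧ (x.2.1 < y.2.1 ∨ (x.2.1 = y.2.1 ∧ x.2.2 < y.2.2)))))

/-- Signed crossing of the planar half-line `{(t, 1/2) : t > 0}` by the projection of a step
from `x` to `y`: `1` for an upward crossing, `-1` for a downward crossing, `0` otherwise. -/
def rayCrossing {k : ℕ} (x y : Vertex k) : ℤ :=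
  if 0 < x.1 ∧ x.2.1 = 0 ∧ y.2.1 = 1 then 1
  else if 0 < x.1 ∧ x.2.1 = 1 ∧ y.2.1 = 0 then -1
  else 0

/-- The winding number around the origin of the projection to `ℤ²` of a closed walk, for walks
whose projection avoids the origin. It is computed as the signed number of crossings of the
half-line `{(t, 1/2) : t > 0}`; a lattice walk that avoids the origin does not meet the segment
from `(0, 0)` to `(0, 1/2)`, so the winding numbers around its two ends agree. -/
def winding {k : ℕ} {v : Vertex k} (w : (slab k).Walk v v) : ℤ :=
  (w.darts.map fun d => rayCrossing d.fst d.snd).sum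

/-- `w` is a `p`-open circuit in `box b \ box a` that surrounds the origin. -/
structure IsOpenCircuit {k : ℕ} (p : ℝ) (ω : Config k) (a b : ℕ) {v : Vertex k}
    (w : (slab k).Walk v v) : Prop where
  isCycle : w.IsCycle
  inside : ∀ u ∈ w.support, u ∈ box k b \ box k a
  surrounds : winding w ≠ 0
  isOpen : ∀ (e : Sym2 (Vertex k)) (he : e ∈ w.edges),
    IsOpenEdge p ω ⟨e, w.edges_subset_edgeSet he⟩

/-- The representative of a circuit, up to cyclic permutation and reversal: it starts at its
smallest vertex, and its second vertex is smaller than its last but one. -/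
def IsRepresentative {k : ℕ} {v : Vertex k} (w : (slab k).Walk v v) : Prop :=
  (∀ u ∈ w.support, u = v ∨ vertexLT v u) ∧ vertexLT w.snd w.penultimate

/-- `w` represents the minimal `p`-open circuit in `box b \ box a` that surrounds the origin,
for the lexicographical ordering of the (representatives of) circuits. -/
def IsMinOpenCircuit {k : ℕ} (p : ℝ) (ω : Config k) (a b : ℕ) {v : Vertex k}
    (w : (slab k).Walk v v) : Prop :=
  IsOpenCircuit p ω a b w ∧ IsRepresentative w ∧
    ∀ (v' : Vertex k) (w' : (slab k).Walk v' v'),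
      IsOpenCircuit p ω a b w' → IsRepresentative w' →
        w'.support = w.support ∨ List.Lex vertexLT w.support w'.support

/-- The event `C_{a,b}`: there is a `p_c`-open circuit in `box b \ box a` around the origin. -/
def circuitEvent (k a b : ℕ) : Set (Config k) :=
  {ω | ∃ (v : Vertex k) (w : (slab k).Walk v v), IsOpenCircuit (pc k) ω a b w}

/-! ### Closed dual surfaces -/

/-- A `p`-closed dual surface in `box b \ box a` that surrounds the origin. The surface is given
by the set `F` of the edges that its plaquettes are perpendicular to: these are closed, they lie
in `box b` but not inside `box a`, and every walk from `box a` to the boundary of `box b`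
crosses one of the plaquettes. -/
structure IsClosedSurface {k : ℕ} (p : ℝ) (ω : Config k) (a b : ℕ) (F : Set (Edge k)) :
    Prop where
  isClosed : ∀ e ∈ F, ¬ IsOpenEdge p ω e
  inside : ∀ e ∈ F, e ∈ edgesIn (box k b) ∧ e ∉ edgesIn (box k a)
  blocks : ∀ u ∈ box k a, ∀ v ∈ vertexBoundary (box k b), ∀ w : (slab k).Walk u v,
    ∃ e ∈ F, e.1 ∈ w.edges

/-- The event `D_{a,b}`: there is a `p_c`-closed dual surface in `box b \ box a` around the
origin. -/
def surfaceEvent (k a b : ℕ) : Set (Config k) :=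
  {ω | ∃ F : Set (Edge k), IsClosedSurface (pc k) ω a b F}

/-! ### Invasion percolation -/

/-- The edges that are not in `H` but incident to some vertex of `H`. -/
def frontierEdges {k : ℕ} (H : (slab k).Subgraph) : Set (Edge k) :=
  {e | e.1 ∉ H.edgeSet ∧ ∃ u ∈ H.verts, u ∈ e.1}

/-- `e` has the lowest label among the edges that are not in `H` but incident to `H`. -/
def IsLowest {k : ℕ} (ω : Config k) (H : (slab k).Subgraph) (e : Edge k) : Prop :=
  e ∈ frontierEdges H ∧ ∀ f ∈ frontierEdges H, ω e ≤ ω f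

/-- One step of the invasion: add the edge of lowest label (and its vertices). The labels are
almost surely distinct, and then this edge is unique; in case of a tie all edges of lowest label
are added. -/
def invasionStep {k : ℕ} (ω : Config k) (H : (slab k).Subgraph) : (slab k).Subgraph where
  verts := {u | u ∈ H.verts ∨ ∃ e, IsLowest ω H e ∧ u ∈ e.1}
  Adj u w := H.Adj u w ∨ ∃ e, IsLowest ω H e ∧ e.1 = s(u, w)
  adj_sub := by
    rintro u w (h | ⟨e, _, he⟩)
    · exact H.adj_sub h
    · have h2 := e.2
      rw [he] at h2
      exact h2
  edge_vert := by
    rintro u w (h | ⟨e, hl, he⟩)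
    · exact Or.inl (H.edge_vert h)
    · exact Or.inr ⟨e, hl, by rw [he]; exact Sym2.mem_mk_left u w⟩
  symm := ⟨by
    rintro u w (h | ⟨e, hl, he⟩)
    · exact Or.inl h.symm
    · exact Or.inr ⟨e, hl, by rw [he]; exact Sym2.eq_swap⟩⟩

/-- The invasion cluster of `v` after `j` steps. -/
def invasion {k : ℕ} (ω : Config k) (v : Vertex k) : ℕ → (slab k).Subgraph
  | 0 => (slab k).singletonSubgraph v
  | j + 1 => invasionStep ω (invasion ω v j)

/-- The invasion cluster of `x`, stopped when it first reaches the boundary of `box n`: the union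
of its stages `j` such that no earlier stage contains a vertex of that boundary. -/
def stoppedInvasion {k : ℕ} (ω : Config k) (x : Vertex k) (n : ℕ) : (slab k).Subgraph :=
  ⨆ (j : ℕ) (_ : ∀ l < j, Disjoint (invasion ω x l).verts (vertexBoundary (box k n))),
    invasion ω x j

/-- The event that the minimal `p_c`-open circuit in `box (2n) \ box n` around the origin is
contained, as a subgraph, in the invasion cluster of `x` stopped at the boundary of `box m`. -/
def gluedEvent (k n m : ℕ) (x : Vertex k) : Set (Config k) :=
  {ω | ∃ (v : Vertex k) (w : (slab k).Walk v v),
    IsMinOpenCircuit (pc k) ω n (2 * n) w ∧ w.toSubgraph ≤ stoppedInvasion ω x m}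

/-- The event `C_{n,2n} ∩ D_{2n,m} ∩ A`. -/
def goodEvent (k n m : ℕ) (A : Set (Config k)) : Set (Config k) :=
  circuitEvent k n (2 * n) ∩ surfaceEvent k (2 * n) m ∩ A

/-- The origin of the slab. -/
def origin (k : ℕ) : Vertex k := (0, 0, 0)

end SlabInvasion

/-! Gluing by local surgery. On the good event, the invasion of `y`, started inside the minimal
circuit, is connected and reaches the boundary of `box m`. By a winding number argument
(`IsOpenCircuit.exists_sameColumn`) it therefore enters a column of the slab that contains a circuit
vertex. In the first such column, open an inclusion-minimal set `T` of vertical edges that joins the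
invasion to the circuit. By minimality each edge of `T` is a bridge of the new open graph, so no
open cycle appears and the minimal circuit is the same (`exists_gluing`). The column lies in `box
(2n) \ box n`, so the surface and `A` are untouched. The invasion now hits the open cluster of the
circuit; as this cluster cannot cross the closed surface, it is exhausted by the time the boundary
is reached (`mem_stoppedInvasion_of_stoppedHits`). Invasions that contained the circuit before still
hit its cluster, hence still contain it.

The cost depends only on `k`: at most `k` edges are resampled, `T` takes at most `2 ^ k` values, and
the column can be read off from the new configuration (`FirstColumn.unique`), so the sum over
columns is free. This gives `prob_gluedGoodEvent_le`. Applied to the origin and then to `x`, it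
bounds the probability of the whole good event, which yields every inequality but the last. The last
one holds because circuit, surface and `A` involve disjoint sets of edges (`prob_mul_le_goodEvent`).
-/

namespace SlabInvasion

/-! ### Resampling coordinates of a product measure -/

section Resample

variable {ι : Type*} {X : ι → Type*}

open Classical in
/-- The configuration that agrees with `η` on `T` and with `ω` elsewhere. -/
noncomputable def resample (T : Set ι) (p : (∀ i, X i) × (∀ i, X i)) : ∀ i, X i :=
  fun i => if i ∈ T then p.2 i else p.1 i

theorem resample_of_mem {T : Set ι} {p : (∀ i, X i) × (∀ i, X i)} {i : ι} (h : i ∈ T) :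
    resample T p i = p.2 i := if_pos h

theorem resample_of_notMem {T : Set ι} {p : (∀ i, X i) × (∀ i, X i)} {i : ι} (h : i ∉ T) :
    resample T p i = p.1 i := if_neg h

variable [∀ i, MeasurableSpace (X i)]

theorem measurable_resample (T : Set ι) : Measurable (resample (X := X) T) := by
  classical
  refine measurable_pi_lambda _ fun i => ?_
  by_cases h : i ∈ T
  · simp only [resample, h, if_true]; fun_prop
  · simp only [resample, h, if_false]; fun_prop

/-- Coordinates in `T` and outside `T` are independent, so mixing two independent samples keeps the
law. On finite-dimensional rectangles the two groups of factors separate. -/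
theorem map_resample (μ : ∀ i, Measure (X i)) [∀ i, IsProbabilityMeasure (μ i)] (T : Set ι) :
    ((Measure.infinitePi μ).prod (Measure.infinitePi μ)).map (resample T)
      = Measure.infinitePi μ := by
  classical
  apply Measure.eq_infinitePi
  intro s t ht
  rw [Measure.map_apply (measurable_resample T)
    (MeasurableSet.pi s.countable_toSet fun i _ => ht i)]
  have h : resample T ⁻¹' Set.pi s t
      = Set.pi (s.filter (· ∉ T)) t ×ˢ Set.pi (s.filter (· ∈ T)) t := by
    ext ⟨ω, η⟩
    simp only [Set.mem_preimage, Set.mem_pi, Set.mem_prod, Finset.mem_coe, Finset.mem_filter]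
    constructor
    · intro h
      refine ⟨fun i hi => ?_, fun i hi => ?_⟩
      · have := h i hi.1
        rwa [resample_of_notMem hi.2] at this
      · have := h i hi.1
        rwa [resample_of_mem hi.2] at this
    · rintro ⟨h₁, h₂⟩ i hi
      by_cases hT : i ∈ T
      · rw [resample_of_mem hT]; exact h₂ i ⟨hi, hT⟩
      · rw [resample_of_notMem hT]; exact h₁ i ⟨hi, hT⟩
  rw [h, Measure.prod_prod, Measure.infinitePi_pi _ fun i _ => ht i,
    Measure.infinitePi_pi _ fun i _ => ht i, mul_comm, Finset.prod_filter_mul_prod_filter_not]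

/-- If resampling the coordinates in `T` by a configuration in `R` maps `F` into `G`, then
`μ F * μ R ≤ μ G`. No measurability is needed. -/
theorem mul_le_of_resample (μ : ∀ i, Measure (X i)) [∀ i, IsProbabilityMeasure (μ i)]
    (T : Set ι) {F R G : Set (∀ i, X i)} (h : ∀ ω ∈ F, ∀ η ∈ R, resample T (ω, η) ∈ G) :
    Measure.infinitePi μ F * Measure.infinitePi μ R ≤ Measure.infinitePi μ G := by
  rw [← Measure.prod_prod]
  calc _ ≤ ((Measure.infinitePi μ).prod (Measure.infinitePi μ)) (resample T ⁻¹' G) :=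
        measure_mono fun p hp => h p.1 hp.1 p.2 hp.2
    _ ≤ _ := Measure.le_map_apply (measurable_resample T).aemeasurable G
    _ = _ := by rw [map_resample]

end Resample

variable {k : ℕ}

instance : IsProbabilityMeasure (prob k) := by unfold prob; infer_instance

theorem prob_mul_le_of_resample (T : Set (Edge k)) {F R G : Set (Config k)}
    (h : ∀ ω ∈ F, ∀ η ∈ R, resample T (ω, η) ∈ G) : prob k F * prob k R ≤ prob k G :=
  mul_le_of_resample _ T h

/-- The labels are almost surely distinct. -/
theorem prob_not_injective : prob k {ω | ¬ Function.Injective ω} = 0 := by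
  have h : {ω : Config k | ¬ Function.Injective ω}
      ⊆ ⋃ (e : Edge k) (f : Edge k) (_ : e ≠ f), {ω | ω e = ω f} := by
    intro ω hω
    simp only [Set.mem_ofPred_eq, Function.Injective, not_forall] at hω
    obtain ⟨e, f, h, hne⟩ := hω
    simp only [Set.mem_iUnion]
    exact ⟨e, f, hne, h⟩
  refine measure_mono_null h ?_
  refine measure_iUnion_null fun e => measure_iUnion_null fun f => measure_iUnion_null fun hne => ?_
  have hm : MeasurableSet {ω : Config k | ω e = ω f} :=
    measurableSet_eq_fun (measurable_pi_apply e) (measurable_pi_apply f)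
  -- Resample the label of `e` alone: given all other labels it is uniform, and so misses the fixed
  -- value `ω f` almost surely.
  have hmap : prob k = ((prob k).prod (prob k)).map (resample {e}) := (map_resample _ _).symm
  rw [hmap, Measure.map_apply (measurable_resample _) hm,
    Measure.measure_prod_null (measurable_resample _ hm)]
  refine Filter.Eventually.of_forall fun ω => ?_
  have hs : (Prod.mk ω ⁻¹' (resample {e} ⁻¹' {ω : Config k | ω e = ω f}))
      = (fun η : Config k => η e) ⁻¹' {ω f} := by
    ext η
    simp only [Set.mem_preimage, Set.mem_ofPred_eq, Set.mem_singleton_iff]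
    rw [resample_of_mem (Set.mem_singleton e),
      resample_of_notMem (fun h => hne (Set.mem_singleton_iff.1 h).symm)]
  simp only [Pi.zero_apply]
  rw [hs, prob, (measurePreserving_eval_infinitePi _ e).measure_preimage
    (measurableSet_singleton _).nullMeasurableSet]
  exact measure_singleton _

/-- The probability that an edge is `p_c`-open. -/
noncomputable def openProb (k : ℕ) : ENNReal := (volume : Measure unitInterval) {t | (t : ℝ) < pc k}

theorem openProb_ne_zero (h : 0 < pc k) : openProb k ≠ 0 := by
  have hs : Set.Ioo (0 : ℝ) (min 1 (pc k)) ⊆ Subtype.val '' {t : unitInterval | (t : ℝ) < pc k} := by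
    rintro t ⟨h₀, h₁⟩
    exact ⟨⟨t, h₀.le, (lt_min_iff.1 h₁).1.le⟩, (lt_min_iff.1 h₁).2, rfl⟩
  rw [openProb, unitInterval.volume_apply]
  refine ne_of_gt (lt_of_lt_of_le ?_ (measure_mono hs))
  rw [Real.volume_Ioo]
  simp [h]

theorem openProb_le_one : openProb k ≤ 1 := prob_le_one

theorem prob_forall_isOpenEdge (T : Finset (Edge k)) :
    prob k {η | ∀ e ∈ T, IsOpenEdge (pc k) η e} = openProb k ^ T.card := by
  have h : {η : Config k | ∀ e ∈ T, IsOpenEdge (pc k) η e}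
      = Set.pi T fun _ => {t : unitInterval | (t : ℝ) < pc k} := by
    ext η; simp [IsOpenEdge, Set.mem_pi]
  rw [h, prob, Measure.infinitePi_pi _ fun i _ => measurableSet_lt measurable_subtype_coe
    measurable_const]
  simp [openProb]

/-! ### Winding numbers -/

theorem slab_adj_cases {x y : Vertex k} (h : (slab k).Adj x y) :
    (x.1 = y.1 ∧ x.2.1 = y.2.1) ∨ (x.1 = y.1 ∧ y.2.1 = x.2.1 + 1) ∨
    (x.1 = y.1 ∧ y.2.1 = x.2.1 - 1) ∨ (x.2.1 = y.2.1 ∧ y.1 = x.1 + 1) ∨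
    (x.2.1 = y.2.1 ∧ y.1 = x.1 - 1) := by
  have h' : (x.1 - y.1) ^ 2 + (x.2.1 - y.2.1) ^ 2
    + (((x.2.2 : ℕ) : ℤ) - ((y.2.2 : ℕ) : ℤ)) ^ 2 = 1 := h
  generalize ha₀ : x.1 - y.1 = a, hb₀ : x.2.1 - y.2.1 = b, (((x.2.2 : ℕ) : ℤ) - ((y.2.2 : ℕ) : ℤ)) = c
    at h'
  have ha : a ≤ 1 := by nlinarith [sq_nonneg b, sq_nonneg c]
  have ha' : -1 ≤ a := by nlinarith [sq_nonneg b, sq_nonneg c]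
  have hb₁ : b ≤ 1 := by nlinarith [sq_nonneg a, sq_nonneg c]
  have hb₂ : -1 ≤ b := by nlinarith [sq_nonneg a, sq_nonneg c]
  have hab : a = 0 ∨ b = 0 := by
    by_contra! hne
    have := Int.one_le_abs hne.1
    have := Int.one_le_abs hne.2
    nlinarith [sq_abs a, sq_abs b, sq_nonneg c]
  omega

/-- Signed crossing of the half-line `{(t, b + 1/2) : t > a}` by the projection of a step. -/
def crossing (a b : ℤ) (x y : Vertex k) : ℤ :=
  if a < x.1 ∧ x.2.1 = b ∧ y.2.1 = b + 1 then 1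
  else if a < x.1 ∧ x.2.1 = b + 1 ∧ y.2.1 = b then -1
  else 0

/-- The winding number of a closed walk around the point `(a, b)` of `ℤ²`. -/
def windingAt (a b : ℤ) {u v : Vertex k} (w : (slab k).Walk u v) : ℤ :=
  (w.darts.map fun d => crossing a b d.fst d.snd).sum

theorem windingAt_zero {v : Vertex k} (w : (slab k).Walk v v) : windingAt 0 0 w = winding w := by
  simp [windingAt, winding, crossing, rayCrossing]

/-- Telescoping. Along a closed walk the sum is zero, so crossing counts that differ by increments
of a vertex function agree. -/
theorem sum_darts_sub (f : Vertex k → ℤ) {u v : Vertex k} (w : (slab k).Walk u v) :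
    (w.darts.map fun d => f d.snd - f d.fst).sum = f v - f u := by
  induction w with
  | nil => simp
  | cons h p ih => simp [ih]

/-- The two counts differ only in steps at abscissa `a + 1` between rows `b` and `b + 1`, and such a
step has an endpoint over `(a + 1, b)`. -/
theorem windingAt_eq_add_one_left {a b : ℤ} {v : Vertex k} (w : (slab k).Walk v v)
    (h : ∀ u ∈ w.support, ¬ (u.1 = a + 1 ∧ u.2.1 = b)) :
    windingAt a b w = windingAt (a + 1) b w := by
  unfold windingAt
  congr 1
  refine List.map_congr_left fun d hd => ?_
  have h₁ := h _ (w.dart_fst_mem_support_of_mem_darts hd)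
  have h₂ := h _ (w.dart_snd_mem_support_of_mem_darts hd)
  have h₃ := slab_adj_cases d.adj
  unfold crossing
  split_ifs <;> omega

/-- The counts differ by the increments of the indicator `f` of row `b + 1` to the right of `a`; a
horizontal step could change `f` only by using `(a, b + 1)`, which the walk avoids. -/
theorem windingAt_eq_add_one_right {a b : ℤ} {v : Vertex k} (w : (slab k).Walk v v)
    (h : ∀ u ∈ w.support, ¬ (u.1 = a ∧ u.2.1 = b + 1)) :
    windingAt a b w = windingAt a (b + 1) w := by
  let f : Vertex k → ℤ := fun u => if a < u.1 ∧ u.2.1 = b + 1 then 1 else 0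
  have key : windingAt a b w = windingAt a (b + 1) w
      + (w.darts.map fun d => f d.snd - f d.fst).sum := by
    unfold windingAt
    rw [← List.sum_map_add]
    congr 1
    refine List.map_congr_left fun d hd => ?_
    have h₁ := h _ (w.dart_fst_mem_support_of_mem_darts hd)
    have h₂ := h _ (w.dart_snd_mem_support_of_mem_darts hd)
    have h₃ := slab_adj_cases d.adj
    unfold crossing
    simp only [f]
    split_ifs <;> omega
  rw [key, sum_darts_sub, sub_self, add_zero]

/-- Unless `a < -N`, no step crosses the half-line. If `a < -N`, the whole walk is to the right of
`a` and the crossings are increments of a height indicator. -/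
theorem windingAt_eq_zero {a b : ℤ} {N : ℕ} {v : Vertex k} (w : (slab k).Walk v v)
    (h : ∀ u ∈ w.support, u ∈ box k N) (hab : ¬ (|a| ≤ (N : ℤ) ∧ |b| ≤ (N : ℤ))) :
    windingAt a b w = 0 := by
  let f : Vertex k → ℤ := fun u => if a < -N ∧ b + 1 ≤ u.2.1 then 1 else 0
  have key : windingAt a b w = (w.darts.map fun d => f d.snd - f d.fst).sum := by
    unfold windingAt
    congr 1
    refine List.map_congr_left fun d hd => ?_
    have h₁ := h _ (w.dart_fst_mem_support_of_mem_darts hd)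
    have h₂ := h _ (w.dart_snd_mem_support_of_mem_darts hd)
    have h₃ := slab_adj_cases d.adj
    simp only [box, Set.mem_ofPred_eq, abs_le] at h₁ h₂ hab
    unfold crossing
    simp only [f]
    split_ifs <;> omega
  rw [key, sum_darts_sub, sub_self]

/-- The winding number is the same around the projections of two neighbouring vertices that are
not above or below the walk. -/
theorem windingAt_eq_of_adj {v : Vertex k} (w : (slab k).Walk v v) {x y : Vertex k}
    (hxy : (slab k).Adj x y)
    (hx : ∀ u ∈ w.support, ¬ (u.1 = x.1 ∧ u.2.1 = x.2.1))
    (hy : ∀ u ∈ w.support, ¬ (u.1 = y.1 ∧ u.2.1 = y.2.1)) :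
    windingAt x.1 x.2.1 w = windingAt y.1 y.2.1 w := by
  rcases slab_adj_cases hxy with ⟨h₁, h₂⟩ | ⟨h₁, h₂⟩ | ⟨h₁, h₂⟩ | ⟨h₁, h₂⟩ | ⟨h₁, h₂⟩
  · rw [h₁, h₂]
  · rw [h₁, h₂]
    exact windingAt_eq_add_one_right w (by rwa [h₂] at hy)
  · have h₃ : x.2.1 = y.2.1 + 1 := by omega
    rw [h₁, h₃]
    exact (windingAt_eq_add_one_right w (by rwa [h₁, h₃] at hx)).symm
  · rw [h₁, h₂]
    exact windingAt_eq_add_one_left w (by rwa [h₂] at hy)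
  · have h₃ : x.1 = y.1 + 1 := by omega
    rw [h₁, h₃]
    exact (windingAt_eq_add_one_left w (by rwa [h₁, h₃] at hx)).symm

/-- A closed walk around the origin in `box N \ box n` has nonzero winding number around every
point of the projection of `box n`. -/
theorem windingAt_ne_zero {n : ℕ} {v : Vertex k} (w : (slab k).Walk v v)
    (h : ∀ u ∈ w.support, u ∉ box k n) (hw : winding w ≠ 0) {x : Vertex k} (hx : x ∈ box k n) :
    windingAt x.1 x.2.1 w ≠ 0 := by
  have hbox : ∀ a b : ℤ, |a| ≤ (n : ℤ) → |b| ≤ (n : ℤ) →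
      ∀ u ∈ w.support, ¬ (u.1 = a ∧ u.2.1 = b) := by
    rintro a b ha hb u hu ⟨rfl, rfl⟩
    exact h u hu ⟨ha, hb⟩
  have h₀ : windingAt 0 0 w ≠ 0 := by rwa [windingAt_zero]
  -- Move from the origin horizontally, then vertically; this path stays in the projection of `box
  -- n`, away from the walk.
  have h₁ : ∀ a : ℤ, |a| ≤ (n : ℤ) → windingAt a 0 w ≠ 0 := by
    intro a
    induction a using Int.induction_on with
    | zero => intro _; exact h₀
    | succ i ih =>
      intro hi
      rw [abs_le] at hi
      rw [← windingAt_eq_add_one_left w (hbox _ _ (by rw [abs_le]; omega) (by simp))]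
      exact ih (by rw [abs_le]; omega)
    | pred i ih =>
      intro hi
      rw [abs_le] at hi
      rw [windingAt_eq_add_one_left w (hbox _ _ (by rw [abs_le]; omega) (by simp))]
      rw [sub_add_cancel]
      exact ih (by rw [abs_le]; omega)
  have h₂ : ∀ b : ℤ, |b| ≤ (n : ℤ) → windingAt x.1 b w ≠ 0 := by
    intro b
    induction b using Int.induction_on with
    | zero => intro _; exact h₁ _ hx.1
    | succ i ih =>
      intro hi
      rw [abs_le] at hi
      rw [← windingAt_eq_add_one_right w (hbox _ _ hx.1 (by rw [abs_le]; omega))]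
      exact ih (by rw [abs_le]; omega)
    | pred i ih =>
      intro hi
      rw [abs_le] at hi
      rw [windingAt_eq_add_one_right w (hbox _ _ hx.1 (by rw [abs_le]; omega))]
      rw [sub_add_cancel]
      exact ih (by rw [abs_le]; omega)
  exact h₂ _ hx.2

/-! ### The minimal circuit -/

/-- These three properties pass to `List.Lex`, so that `exists_least_of_finite` applies to circuits
as well as to vertices. -/
instance : Std.Asymm (vertexLT (k := k)) where
  asymm x y := by
    unfold vertexLT
    simp only [Fin.lt_def]
    omega

instance : Std.Trichotomous (vertexLT (k := k)) where
  trichotomous x y := by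
    unfold vertexLT
    simp only [Fin.lt_def]
    intro h₁ h₂
    refine Prod.ext ?_ (Prod.ext ?_ (Fin.ext ?_)) <;> omega

instance : IsOrderConnected (Vertex k) vertexLT where
  conn x y z := by
    unfold vertexLT
    simp only [Fin.lt_def]
    omega

theorem exists_least_of_finite {α : Type*} (r : α → α → Prop) [Std.Asymm r] [Std.Trichotomous r]
    [IsOrderConnected α r] {s : Set α} (hs : s.Finite) (hne : s.Nonempty) :
    ∃ a ∈ s, ∀ b ∈ s, b = a ∨ r a b := by
  have : IsStrictWeakOrder α r := isStrictWeakOrder_of_isOrderConnected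
  have : IsStrictOrder α r := {}
  obtain ⟨x, hx⟩ := hne
  obtain ⟨a, -, ha⟩ := (Set.Finite.wellFoundedOn (r := r) hs).has_min Set.univ ⟨⟨x, hx⟩, trivial⟩
  refine ⟨a, a.2, fun b hb => ?_⟩
  rcases trichotomous_of r a b with h | h | h
  · exact Or.inr h
  · exact Or.inl h.symm
  · exact absurd h (ha ⟨b, hb⟩ trivial)

theorem box_finite (n : ℕ) : (box k n).Finite := by
  refine Set.Finite.subset ((Set.finite_Icc (-(n : ℤ)) n).prod
    ((Set.finite_Icc (-(n : ℤ)) n).prod (Set.finite_univ (α := Fin (k + 1))))) ?_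
  rintro x ⟨h₁, h₂⟩
  exact ⟨abs_le.1 h₁, abs_le.1 h₂, trivial⟩

/-- By asymmetry of the order. It allows different witnesses of the minimal circuit to be
identified. -/
theorem IsMinOpenCircuit.support_eq {p : ℝ} {ω : Config k} {a b : ℕ} {v v' : Vertex k}
    {w : (slab k).Walk v v} {w' : (slab k).Walk v' v'} (h : IsMinOpenCircuit p ω a b w)
    (h' : IsMinOpenCircuit p ω a b w') : w'.support = w.support := by
  rcases h.2.2 _ w' h'.1 h'.2.1 with h₁ | h₁
  · exact h₁
  · rcases h'.2.2 _ w h.1 h.2.1 with h₂ | h₂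
    · exact h₂.symm
    · exact absurd h₂ (asymm h₁)

theorem winding_rotate {u v : Vertex k} (w : (slab k).Walk v v) (h : u ∈ w.support) :
    winding (w.rotate u h) = winding w :=
  ((w.rotate_darts u h).perm.map _).sum_eq

theorem winding_reverse {v : Vertex k} (w : (slab k).Walk v v) :
    winding w.reverse = - winding w := by
  unfold winding
  rw [SimpleGraph.Walk.darts_reverse, List.map_reverse, List.sum_reverse, List.map_map]
  have hneg : ∀ (l : List (slab k).Dart) (f : (slab k).Dart → ℤ),
      (l.map fun d => - f d).sum = - (l.map f).sum := by
    intro l f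
    induction l with
    | nil => rfl
    | cons d l ih => simp [ih, add_comm]
  rw [← hneg]
  congr 1
  refine List.map_congr_left fun d _ => ?_
  have h₃ := slab_adj_cases d.adj
  simp only [Function.comp, SimpleGraph.Dart.symm, Prod.swap, rayCrossing]
  split_ifs <;> omega

theorem IsOpenCircuit.rotate {p : ℝ} {ω : Config k} {a b : ℕ} {v u : Vertex k}
    {w : (slab k).Walk v v} (h : IsOpenCircuit p ω a b w) (hu : u ∈ w.support) :
    IsOpenCircuit p ω a b (w.rotate u hu) where
  isCycle := h.isCycle.rotate hu
  inside x hx := h.inside x ((w.mem_support_rotate_iff u hu).1 hx)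
  surrounds := by rw [winding_rotate]; exact h.surrounds
  isOpen e he := h.isOpen e ((w.rotate_edges u hu).mem_iff.1 he)

theorem IsOpenCircuit.reverse {p : ℝ} {ω : Config k} {a b : ℕ} {v : Vertex k}
    {w : (slab k).Walk v v} (h : IsOpenCircuit p ω a b w) :
    IsOpenCircuit p ω a b w.reverse where
  isCycle := h.isCycle.reverse
  inside x hx := h.inside x (by simpa using hx)
  surrounds := by rw [winding_reverse]; exact neg_ne_zero.2 h.surrounds
  isOpen e he := h.isOpen e (by simpa using he)

theorem IsOpenCircuit.exists_representative {p : ℝ} {ω : Config k} {a b : ℕ} {v : Vertex k}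
    {w : (slab k).Walk v v} (h : IsOpenCircuit p ω a b w) :
    ∃ (v' : Vertex k) (w' : (slab k).Walk v' v'), IsOpenCircuit p ω a b w' ∧
      IsRepresentative w' := by
  obtain ⟨u, hu, hmin⟩ := exists_least_of_finite vertexLT (List.finite_toSet w.support)
    ⟨v, w.start_mem_support⟩
  have hmin' : ∀ x ∈ (w.rotate u hu).support, x = u ∨ vertexLT u x := fun x hx =>
    hmin x ((w.mem_support_rotate_iff u hu).1 hx)
  have hr := h.rotate hu
  rcases trichotomous_of vertexLT (w.rotate u hu).snd (w.rotate u hu).penultimate with h₁ | h₁ | h₁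
  · exact ⟨u, _, hr, hmin', h₁⟩
  · exact absurd h₁ hr.isCycle.snd_ne_penultimate
  · refine ⟨u, _, hr.reverse, fun x hx => hmin' x (by simpa using hx), ?_⟩
    rwa [SimpleGraph.Walk.snd_reverse, SimpleGraph.Walk.penultimate_reverse]

/-- A cycle repeats only its starting vertex, so only finitely many supports fit into the finite
`box b`. -/
theorem IsOpenCircuit.exists_min {p : ℝ} {ω : Config k} {a b : ℕ} {v : Vertex k}
    {w : (slab k).Walk v v} (h : IsOpenCircuit p ω a b w) :
    ∃ (v' : Vertex k) (w' : (slab k).Walk v' v'), IsMinOpenCircuit p ω a b w' := by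
  let S : Set (List (Vertex k)) := {l | ∃ (v' : Vertex k) (w' : (slab k).Walk v' v'),
    IsOpenCircuit p ω a b w' ∧ IsRepresentative w' ∧ w'.support = l}
  have hS : S.Finite := by
    have : Finite (box k b) := box_finite b
    have := Fintype.ofFinite (box k b)
    refine ((List.finite_length_le (box k b) (Fintype.card (box k b) + 1)).image
      (List.map Subtype.val)).subset ?_
    rintro l ⟨v', w', h₁, -, rfl⟩
    have hin : ∀ x ∈ w'.support, x ∈ box k b := fun x hx => (h₁.inside x hx).1
    obtain ⟨l, hl⟩ : w'.support ∈ Set.range (List.map ((↑) : box k b → Vertex k)) := by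
      rw [Set.range_list_map_coe]
      exact hin
    refine ⟨l, ?_, hl⟩
    have hnd := h₁.isCycle.support_nodup
    rw [← hl, ← List.map_tail] at hnd
    have hcard := (List.Nodup.of_map _ hnd).length_le_card
    rw [List.length_tail] at hcard
    exact Nat.sub_le_iff_le_add.1 hcard
  obtain ⟨v₁, w₁, h₁, hr₁⟩ := h.exists_representative
  obtain ⟨l, ⟨v₂, w₂, h₂, hr₂, rfl⟩, hmin⟩ :=
    exists_least_of_finite (List.Lex vertexLT) hS ⟨_, v₁, w₁, h₁, hr₁, rfl⟩
  exact ⟨v₂, w₂, h₂, hr₂, fun v' w' h' hr' => hmin _ ⟨v', w', h', hr', rfl⟩⟩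

/-! ### Invasion clusters -/

theorem invasion_succ (ω : Config k) (x : Vertex k) (j : ℕ) :
    invasion ω x (j + 1) = invasionStep ω (invasion ω x j) := rfl

theorem le_invasionStep (ω : Config k) (H : (slab k).Subgraph) : H ≤ invasionStep ω H :=
  ⟨fun _ h => Or.inl h, fun _ _ h => Or.inl h⟩

theorem invasion_mono (ω : Config k) (x : Vertex k) : Monotone (invasion ω x) :=
  monotone_nat_of_le_succ fun j => le_invasionStep ω (invasion ω x j)

theorem IsLowest.mem_edgeSet {ω : Config k} {H : (slab k).Subgraph} {e : Edge k}
    (h : IsLowest ω H e) : e.1 ∈ (invasionStep ω H).edgeSet := by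
  obtain ⟨⟨u, v⟩, he⟩ := e
  exact Or.inr ⟨_, h, rfl⟩

theorem exists_of_mem_invasionStep {ω : Config k} {H : (slab k).Subgraph} {u : Vertex k}
    (h : u ∈ (invasionStep ω H).verts) (hu : u ∉ H.verts) :
    ∃ a ∈ H.verts, ∃ e, IsLowest ω H e ∧ e.1 = s(a, u) := by
  obtain ⟨e, he, hue⟩ := h.resolve_left hu
  obtain ⟨a, ha, hae⟩ := he.1.2
  exact ⟨a, ha, e, he, (Sym2.mem_and_mem_iff (ne_of_mem_of_not_mem ha hu)).1 ⟨hae, hue⟩⟩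

theorem adj_of_edge_eq {e : Edge k} {a u : Vertex k} (h : e.1 = s(a, u)) : (slab k).Adj a u := by
  have := e.2
  rwa [h] at this

theorem box_mono {a b : ℕ} (h : a ≤ b) : box k a ⊆ box k b := fun _ hx =>
  ⟨hx.1.trans (by exact_mod_cast h), hx.2.trans (by exact_mod_cast h)⟩

theorem mem_box_succ_of_adj {n : ℕ} {u v : Vertex k} (hu : u ∈ box k n) (h : (slab k).Adj u v) :
    v ∈ box k (n + 1) := by
  have h₃ := slab_adj_cases h
  simp only [box, Set.mem_ofPred_eq, abs_le] at hu ⊢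
  push_cast
  omega

theorem exists_mem_box (x : Vertex k) : ∃ n, x ∈ box k n := by
  refine ⟨x.1.natAbs + x.2.1.natAbs, ?_⟩
  simp only [box, Set.mem_ofPred_eq, abs_le]
  omega

theorem edgesIn_finite {U : Set (Vertex k)} (hU : U.Finite) : (edgesIn U).Finite := by
  have h : ((fun q : Vertex k × Vertex k => s(q.1, q.2)) '' (U ×ˢ U)).Finite :=
    (hU.prod hU).image _
  refine Set.Finite.subset (h.preimage Subtype.val_injective.injOn) ?_
  rintro ⟨⟨u, v⟩, he⟩ hU'
  exact ⟨(u, v), ⟨hU' u (Sym2.mem_mk_left u v), hU' v (Sym2.mem_mk_right u v)⟩, rfl⟩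

theorem frontierEdges_finite {H : (slab k).Subgraph} {n : ℕ} (h : H.verts ⊆ box k n) :
    (frontierEdges H).Finite := by
  refine (edgesIn_finite (box_finite (k := k) (n + 1))).subset ?_
  rintro ⟨e, he⟩ ⟨-, u, hu, hue⟩ v hv
  by_cases huv : u = v
  · exact huv ▸ box_mono n.le_succ (h hu)
  · exact mem_box_succ_of_adj (h hu)
      (adj_of_edge_eq (e := ⟨e, he⟩) ((Sym2.mem_and_mem_iff huv).1 ⟨hue, hv⟩))

theorem frontierEdges_nonempty {H : (slab k).Subgraph} {n : ℕ} (h : H.verts ⊆ box k n)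
    (hne : H.verts.Nonempty) : (frontierEdges H).Nonempty := by
  obtain ⟨u, hu, hmax⟩ := Set.exists_max_image H.verts (fun u => u.1) ((box_finite n).subset h) hne
  have hadj : (slab k).Adj u (u.1 + 1, u.2) := by simp [slab]
  refine ⟨⟨s(u, (u.1 + 1, u.2)), hadj⟩, fun hmem => ?_, u, hu, Sym2.mem_mk_left _ _⟩
  have := hmax _ (H.edge_vert (H.symm.symm _ _ hmem))
  simp at this

theorem exists_isLowest (ω : Config k) {H : (slab k).Subgraph} {n : ℕ} (h : H.verts ⊆ box k n)
    (hne : H.verts.Nonempty) : ∃ e, IsLowest ω H e :=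
  Set.exists_min_image _ ω (frontierEdges_finite h) (frontierEdges_nonempty h hne)

theorem mem_invasion_self (ω : Config k) (x : Vertex k) (j : ℕ) : x ∈ (invasion ω x j).verts :=
  (invasion_mono ω x (Nat.zero_le j)).1 (Set.mem_singleton x)

theorem exists_invasion_subset_box (ω : Config k) (x : Vertex k) (j : ℕ) :
    ∃ n, (invasion ω x j).verts ⊆ box k n := by
  induction j with
  | zero =>
    obtain ⟨n, hn⟩ := exists_mem_box x
    exact ⟨n, fun u hu => by rw [Set.mem_singleton_iff.1 hu]; exact hn⟩
  | succ j ih =>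
    obtain ⟨n, hn⟩ := ih
    refine ⟨n + 1, fun u hu => ?_⟩
    by_cases hu' : u ∈ (invasion ω x j).verts
    · exact box_mono n.le_succ (hn hu')
    · obtain ⟨a, ha, e, -, he⟩ := exists_of_mem_invasionStep hu hu'
      exact mem_box_succ_of_adj (hn ha) (adj_of_edge_eq he)

theorem exists_isLowest_invasion (ω : Config k) (x : Vertex k) (j : ℕ) :
    ∃ e, IsLowest ω (invasion ω x j) e := by
  obtain ⟨n, hn⟩ := exists_invasion_subset_box ω x j
  exact exists_isLowest ω hn ⟨x, mem_invasion_self ω x j⟩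

theorem invasion_subset_box {ω : Config k} {x : Vertex k} {m : ℕ} (hx : x ∈ box k m) {j : ℕ}
    (h : ∀ l < j, Disjoint (invasion ω x l).verts (vertexBoundary (box k m))) :
    (invasion ω x j).verts ⊆ box k m := by
  induction j with
  | zero => exact fun u hu => by rw [Set.mem_singleton_iff.1 hu]; exact hx
  | succ j ih =>
    have ih := ih fun l hl => h l (hl.trans j.lt_succ_self)
    intro u hu
    by_cases hu' : u ∈ (invasion ω x j).verts
    · exact ih hu'
    · obtain ⟨a, ha, e, -, he⟩ := exists_of_mem_invasionStep hu hu'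
      by_contra hbox
      exact Set.disjoint_left.1 (h j j.lt_succ_self) ha ⟨ih ha, u, hbox, adj_of_edge_eq he⟩

/-- The invasion cluster of a vertex of `box m` reaches the boundary of `box m`. -/
theorem exists_invasion_reaches (ω : Config k) {x : Vertex k} {m : ℕ} (hx : x ∈ box k m) :
    ∃ j, ¬ Disjoint (invasion ω x j).verts (vertexBoundary (box k m)) := by
  by_contra! h
  let S : ℕ → Set (Edge k) := fun j => {e | e.1 ∈ (invasion ω x j).edgeSet}
  have hS : ∀ j, S j ⊆ edgesIn (box k m) := by
    intro j e he u hu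
    exact invasion_subset_box hx (fun l _ => h l) ((invasion ω x j).mem_verts_of_mem_edge he hu)
  have hfin := edgesIn_finite (box_finite (k := k) m)
  have hcard : ∀ j, j ≤ (S j).ncard := by
    intro j
    induction j with
    | zero => exact Nat.zero_le _
    | succ j ih =>
      refine Nat.succ_le_of_lt (lt_of_le_of_lt ih ?_)
      refine Set.ncard_lt_ncard ?_ (hfin.subset (hS _))
      obtain ⟨e, he⟩ := exists_isLowest_invasion ω x j
      refine (Set.ssubset_iff_of_subset fun f hf => ?_).2 ⟨e, he.mem_edgeSet, he.1.1⟩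
      exact SimpleGraph.Subgraph.edgeSet_mono (invasion_mono ω x j.le_succ) hf
  have := (hcard ((edgesIn (box k m)).ncard + 1)).trans (Set.ncard_le_ncard (hS _) hfin)
  omega

/-- The stages of the invasion depend only on the labels of the edges incident to the earlier
stages. -/
theorem invasion_congr {ω ω' : Config k} {x : Vertex k} {s : ℕ}
    (h : ∀ l < s, ∀ e : Edge k, (∃ u ∈ (invasion ω x l).verts, u ∈ e.1) → ω' e = ω e) :
    ∀ l ≤ s, invasion ω' x l = invasion ω x l := by
  intro l
  induction l with
  | zero => intro _; rfl
  | succ l ih =>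
    intro hl
    have hlow : ∀ e, IsLowest ω' (invasion ω x l) e ↔ IsLowest ω (invasion ω x l) e := by
      intro e
      have h' : ∀ f ∈ frontierEdges (invasion ω x l), ω' f = ω f := fun f hf => h l hl f hf.2
      refine and_congr_right fun he => forall₂_congr fun f hf => ?_
      rw [h' e he, h' f hf]
    rw [invasion_succ, invasion_succ, ih (Nat.le_of_succ_le hl)]
    ext <;> simp [invasionStep, hlow]

/-- The invasion cluster of `x`, stopped at the boundary of `box m`, contains a vertex of `V`. -/
def StoppedHits (ω : Config k) (x : Vertex k) (m : ℕ) (V : Set (Vertex k)) : Prop :=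
  ∃ s, (∀ l < s, Disjoint (invasion ω x l).verts (vertexBoundary (box k m))) ∧
    ∃ u ∈ (invasion ω x s).verts, u ∈ V

theorem mem_stoppedInvasion_verts {ω : Config k} {x u : Vertex k} {m : ℕ} :
    u ∈ (stoppedInvasion ω x m).verts ↔
      ∃ s, (∀ l < s, Disjoint (invasion ω x l).verts (vertexBoundary (box k m))) ∧
        u ∈ (invasion ω x s).verts := by
  simp [stoppedInvasion, SimpleGraph.Subgraph.verts_iSup]

theorem StoppedHits.of_mem {ω : Config k} {x u : Vertex k} {m : ℕ} {V : Set (Vertex k)}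
    (h : u ∈ (stoppedInvasion ω x m).verts) (hu : u ∈ V) : StoppedHits ω x m V := by
  obtain ⟨s, hs, h⟩ := mem_stoppedInvasion_verts.1 h
  exact ⟨s, hs, u, h, hu⟩

/-- Changing labels of edges inside `V` does not affect whether the stopped invasion hits `V`. -/
theorem StoppedHits.congr {ω ω' : Config k} {x : Vertex k} {m : ℕ} {V : Set (Vertex k)}
    (h : StoppedHits ω x m V) (hω : ∀ e : Edge k, (∃ u ∈ e.1, u ∉ V) → ω' e = ω e) :
    StoppedHits ω' x m V := by
  classical
  obtain ⟨s₀, hs₀, h₀⟩ := h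
  have hex : ∃ s, ∃ u ∈ (invasion ω x s).verts, u ∈ V := ⟨s₀, h₀⟩
  have hle : Nat.find hex ≤ s₀ := Nat.find_min' hex h₀
  -- Before the first hit, every edge incident to a stage has an endpoint outside `V`, so its label
  -- is unchanged.
  have heq := invasion_congr (ω := ω) (ω' := ω') (x := x) (s := Nat.find hex) (by
    rintro l hl e ⟨u, hu, hue⟩
    exact hω e ⟨u, hue, fun huV => Nat.find_min hex hl ⟨u, hu, huV⟩⟩)
  refine ⟨Nat.find hex, fun l hl => ?_, ?_⟩
  · rw [heq l hl.le]
    exact hs₀ l (hl.trans_le hle)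
  · rw [heq _ le_rfl]
    exact Nat.find_spec hex

/-! ### Open clusters -/

theorem mem_edgeSet_openGraph {p : ℝ} {ω : Config k} {e : Edge k} :
    e.1 ∈ (openGraph p ω).edgeSet ↔ IsOpenEdge p ω e := by
  obtain ⟨⟨u, v⟩, he⟩ := e
  exact ⟨fun ⟨_, h⟩ => h, fun h => ⟨he, h⟩⟩

theorem openGraph_le_slab (p : ℝ) (ω : Config k) : openGraph p ω ≤ slab k := fun _ _ h => h.1

theorem mem_cluster_of_isOpenEdge {p : ℝ} {ω : Config k} {g : Vertex k} {e : Edge k}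
    (h : IsOpenEdge p ω e) {u v : Vertex k} (hu : u ∈ cluster p ω g) (hue : u ∈ e.1)
    (hve : v ∈ e.1) : v ∈ cluster p ω g := by
  by_cases huv : u = v
  · exact huv ▸ hu
  · have := mem_edgeSet_openGraph.2 h
    rw [(Sym2.mem_and_mem_iff huv).1 ⟨hue, hve⟩] at this
    exact SimpleGraph.Reachable.trans hu (SimpleGraph.Adj.reachable this)

theorem IsClosedSurface.notMem_boundary {p : ℝ} {ω : Config k} {a m : ℕ} {F : Set (Edge k)}
    (hF : IsClosedSurface p ω a m F) {g u : Vertex k} (hg : g ∈ box k a)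
    (hu : u ∈ cluster p ω g) : u ∉ vertexBoundary (box k m) := by
  intro hb
  obtain ⟨w⟩ := hu
  obtain ⟨e, heF, he⟩ := hF.blocks g hg u hb (w.mapLe (openGraph_le_slab p ω))
  rw [SimpleGraph.Walk.edges_mapLe_eq_edges] at he
  exact hF.isClosed e heF (mem_edgeSet_openGraph.1 (w.edges_subset_edgeSet he))

/-- If no open edge incident to `H` is missing from `H`, then `H` contains every open cluster that
it meets. -/
theorem cluster_subset_verts {p : ℝ} {ω : Config k} {H : (slab k).Subgraph}
    (hH : ∀ e ∈ frontierEdges H, ¬ IsOpenEdge p ω e) {g q : Vertex k} (hq : q ∈ H.verts)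
    (hqg : q ∈ cluster p ω g) : cluster p ω g ⊆ H.verts := by
  intro u hu
  obtain ⟨w⟩ : (openGraph p ω).Reachable q u := SimpleGraph.Reachable.trans hqg.symm hu
  clear hqg hu
  induction w with
  | nil => exact hq
  | @cons a b c hab w ih =>
    refine ih ?_
    by_contra hb
    refine hH ⟨s(a, b), hab.1⟩ ⟨fun hmem => hb (H.edge_vert (H.symm.symm _ _ hmem)), a, hq,
      Sym2.mem_mk_left a b⟩ hab.2

/-- In the presence of a closed surface, a stopped invasion that hits an open cluster inside of
the surface contains all open edges of this cluster. -/
theorem mem_stoppedInvasion_of_stoppedHits {p : ℝ} {ω : Config k} (hinj : Function.Injective ω)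
    {a m : ℕ} {F : Set (Edge k)} (hF : IsClosedSurface p ω a m F) {x g : Vertex k}
    (hx : x ∈ box k m) (hg : g ∈ box k a) (hit : StoppedHits ω x m (cluster p ω g))
    {e : Edge k} (he : IsOpenEdge p ω e) {u : Vertex k} (hue : u ∈ e.1)
    (hu : u ∈ cluster p ω g) : e.1 ∈ (stoppedInvasion ω x m).edgeSet := by
  classical
  set O := cluster p ω g with hO
  obtain ⟨s₀, hs₀, hit₀⟩ := hit
  have hexl : ∃ s, ∃ u ∈ (invasion ω x s).verts, u ∈ O := ⟨s₀, hit₀⟩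
  have hexJ := exists_invasion_reaches ω hx
  obtain ⟨l, hl⟩ : ∃ l, l = Nat.find hexl := ⟨_, rfl⟩
  have hlspec : ∃ u ∈ (invasion ω x l).verts, u ∈ O := hl ▸ Nat.find_spec hexl
  have hlmin : ∀ j < l, ¬ ∃ u ∈ (invasion ω x j).verts, u ∈ O := fun j hj =>
    Nat.find_min hexl (hl ▸ hj)
  have hlJ : l ≤ Nat.find hexJ := by
    have h₁ : l ≤ s₀ := hl ▸ Nat.find_min' hexl hit₀
    by_contra! h₂
    exact Nat.find_spec hexJ (hs₀ _ (h₂.trans_le h₁))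
  have hJmin : ∀ j < Nat.find hexJ,
      Disjoint (invasion ω x j).verts (vertexBoundary (box k m)) := fun j hj =>
    not_not.1 (Nat.find_min hexJ hj)
  -- `V` is the invasion just before it first hits `O` (empty if it starts there). The step into `O`
  -- uses a closed edge, as an open one would have both ends in `O`; since that edge is lowest, no
  -- open edge at `V` is left over.
  obtain ⟨V, hVb, hVl, hVopen⟩ : ∃ V : Set (Vertex k),
      Disjoint V (vertexBoundary (box k m)) ∧ (invasion ω x l).verts ⊆ V ∪ O ∧
      ∀ f : Edge k, IsOpenEdge p ω f → (∃ v ∈ V, v ∈ f.1) → f.1 ∈ (invasion ω x l).edgeSet := by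
    rcases l with _ | l
    · refine ⟨∅, Set.empty_disjoint _, ?_, by simp⟩
      obtain ⟨q, hq, hqO⟩ := hlspec
      intro v hv
      rw [Set.mem_singleton_iff.1 hv, ← Set.mem_singleton_iff.1 hq]
      exact Or.inr hqO
    · have hno := hlmin l l.lt_succ_self
      obtain ⟨q, hq, hqO⟩ := hlspec
      obtain ⟨b, hb, f, hf, hfe⟩ := exists_of_mem_invasionStep hq fun h => hno ⟨q, h, hqO⟩
      have hfclosed : ¬ IsOpenEdge p ω f := fun h => hno ⟨b, hb, mem_cluster_of_isOpenEdge h hqO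
        (hfe ▸ Sym2.mem_mk_right b q) (hfe ▸ Sym2.mem_mk_left b q)⟩
      refine ⟨(invasion ω x l).verts, hJmin l hlJ, fun v hv => ?_, fun f' hf' hv => ?_⟩
      · by_cases hv' : v ∈ (invasion ω x l).verts
        · exact Or.inl hv'
        · obtain ⟨b', -, f', hf', hfe'⟩ := exists_of_mem_invasionStep hv hv'
          have : f' = f := hinj (le_antisymm (hf'.2 f hf.1) (hf.2 f' hf'.1))
          subst this
          have hvf : v ∈ f'.1 := hfe' ▸ Sym2.mem_mk_right b' v
          rw [hfe, Sym2.mem_iff] at hvf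
          rcases hvf with rfl | rfl
          · exact Or.inl hb
          · exact Or.inr hqO
      · by_contra hmem
        refine hfclosed (lt_of_le_of_lt (Subtype.coe_le_coe.2 (hf.2 f' ⟨fun h => hmem ?_, hv⟩)) hf')
        exact SimpleGraph.Subgraph.edgeSet_mono (invasion_mono ω x l.le_succ) h
  -- While an open frontier edge remains, the next edge is open; it cannot touch `V`, so it stays in
  -- `O`. Once none remains, the cluster is exhausted.
  have key : ∀ s, l ≤ s → (∀ f : Edge k, IsOpenEdge p ω f → (∃ v ∈ f.1, v ∈ O) →
      f.1 ∈ (invasion ω x s).edgeSet) ∨ (invasion ω x s).verts ⊆ V ∪ O := by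
    intro s hs
    induction s, hs using Nat.le_induction with
    | base => exact Or.inr hVl
    | succ s hs ih =>
      have hmono := SimpleGraph.Subgraph.edgeSet_mono (invasion_mono ω x s.le_succ)
      rcases ih with ih | ih
      · exact Or.inl fun f hf hv => hmono (ih f hf hv)
      by_cases hfr : ∀ f ∈ frontierEdges (invasion ω x s), ¬ IsOpenEdge p ω f
      · left
        rintro f hf ⟨v, hvf, hvO⟩
        obtain ⟨q, hq, hqO⟩ := hlspec
        have hsub := cluster_subset_verts hfr ((invasion_mono ω x hs).1 hq) hqO
        by_contra hmem
        exact hfr f ⟨fun h => hmem (hmono h), v, hsub hvO, hvf⟩ hf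
      · right
        push Not at hfr
        obtain ⟨f, hf, hfo⟩ := hfr
        intro v hv
        by_cases hv' : v ∈ (invasion ω x s).verts
        · exact ih hv'
        · obtain ⟨b, hb, f', hf', hfe'⟩ := exists_of_mem_invasionStep hv hv'
          have hfo' : IsOpenEdge p ω f' :=
            lt_of_le_of_lt (Subtype.coe_le_coe.2 (hf'.2 f hf)) hfo
          have hbf : b ∈ f'.1 := hfe' ▸ Sym2.mem_mk_left b v
          rcases ih hb with hbV | hbO
          · exact absurd (SimpleGraph.Subgraph.edgeSet_mono (invasion_mono ω x hs)
              (hVopen f' hfo' ⟨b, hbV, hbf⟩)) hf'.1.1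
          · exact Or.inr (mem_cluster_of_isOpenEdge hfo' hbO hbf
              (hfe' ▸ Sym2.mem_mk_right b v))
  have hle : invasion ω x (Nat.find hexJ) ≤ stoppedInvasion ω x m :=
    le_iSup₂_of_le (Nat.find hexJ) hJmin le_rfl
  -- At the boundary the second alternative fails: neither `V` nor `O`, which the surface encloses,
  -- meets it.
  rcases key _ hlJ with h | h
  · exact SimpleGraph.Subgraph.edgeSet_mono hle (h e he ⟨u, hue, hu⟩)
  · obtain ⟨b, hb, hbb⟩ := Set.not_disjoint_iff.1 (Nat.find_spec hexJ)
    rcases h hb with hbV | hbO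
    · exact absurd hbb (Set.disjoint_left.1 hVb hbV)
    · exact absurd hbb (hF.notMem_boundary hg hbO)

/-! ### The first column of a circuit that is hit by an invasion -/

/-- `x` and `y` have the same projection to `ℤ²`. -/
def SameColumn (x y : Vertex k) : Prop := x.1 = y.1 ∧ x.2.1 = y.2.1

/-- The vertices that project to `z`. -/
def column (k : ℕ) (z : ℤ × ℤ) : Set (Vertex k) := {u | u.1 = z.1 ∧ u.2.1 = z.2}

theorem notMem_box_of_mem_boundary {a m : ℕ} (h : a < m) {u : Vertex k}
    (hu : u ∈ vertexBoundary (box k m)) : u ∉ box k a := by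
  intro hua
  obtain ⟨-, v, hv, huv⟩ := hu
  exact hv (box_mono h (mem_box_succ_of_adj hua huv))

/-- A stopped invasion that starts inside of a circuit passes above or below the circuit. -/
theorem IsOpenCircuit.exists_sameColumn {p : ℝ} {ω ω' : Config k} {a b m : ℕ} (hbm : b < m)
    (hab : a ≤ b) {v : Vertex k} {w : (slab k).Walk v v} (hw : IsOpenCircuit p ω' a b w)
    {y : Vertex k} (hy : y ∈ box k a) :
    ∃ j, (∀ l < j + 1, Disjoint (invasion ω y l).verts (vertexBoundary (box k m))) ∧
      (∀ u ∈ (invasion ω y j).verts, ∀ g ∈ w.support, ¬ SameColumn u g) ∧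
      ∃ u ∈ (invasion ω y (j + 1)).verts, ∃ g ∈ w.support, SameColumn u g := by
  classical
  have hym : y ∈ box k m := box_mono (hab.trans hbm.le) hy
  have hexJ := exists_invasion_reaches ω hym
  have hJmin : ∀ j < Nat.find hexJ,
      Disjoint (invasion ω y j).verts (vertexBoundary (box k m)) := fun j hj =>
    not_not.1 (Nat.find_min hexJ hj)
  have hex : ∃ s ≤ Nat.find hexJ, ∃ u ∈ (invasion ω y s).verts, ∃ g ∈ w.support,
      SameColumn u g := by
    by_contra! hno
    -- Each new vertex is adjacent to an old one, so a nonzero winding number propagates while the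
    -- columns of the circuit are avoided. On the boundary, outside `box b`, it would vanish.
    have hwind : ∀ s ≤ Nat.find hexJ, ∀ u ∈ (invasion ω y s).verts,
        windingAt u.1 u.2.1 w ≠ 0 := by
      intro s
      induction s with
      | zero =>
        intro _ u hu
        rw [Set.mem_singleton_iff.1 hu]
        exact windingAt_ne_zero w (fun g hg => (hw.inside g hg).2) hw.surrounds hy
      | succ s ih =>
        intro hs u hu
        by_cases hu' : u ∈ (invasion ω y s).verts
        · exact ih (Nat.le_of_succ_le hs) u hu'
        · obtain ⟨c, hc, e, -, he⟩ := exists_of_mem_invasionStep hu hu'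
          rw [← windingAt_eq_of_adj w (adj_of_edge_eq he)]
          · exact ih (Nat.le_of_succ_le hs) c hc
          · exact fun g hg h => hno s (Nat.le_of_succ_le hs) c hc g hg ⟨h.1.symm, h.2.symm⟩
          · exact fun g hg h => hno (s + 1) hs u hu g hg ⟨h.1.symm, h.2.symm⟩
    obtain ⟨c, hc, hcb⟩ := Set.not_disjoint_iff.1 (Nat.find_spec hexJ)
    exact hwind _ le_rfl c hc (windingAt_eq_zero w (fun g hg => (hw.inside g hg).1)
      (notMem_box_of_mem_boundary hbm hcb))
  obtain ⟨s, hs⟩ : ∃ s, s = Nat.find hex := ⟨_, rfl⟩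
  have hspec := Nat.find_spec hex
  have hmin : ∀ l < s, ¬ _ := fun l hl => Nat.find_min hex (hs ▸ hl)
  rw [← hs] at hspec
  obtain ⟨hsJ, u, hu, g, hg, hug⟩ := hspec
  rcases s with _ | j
  · rw [Set.mem_singleton_iff.1 hu] at hug
    refine absurd ?_ (hw.inside g hg).2
    exact ⟨hug.1 ▸ hy.1, hug.2 ▸ hy.2⟩
  · exact ⟨j, fun l hl => hJmin l (hl.trans_le hsJ), fun u' hu' g' hg' h =>
      hmin j j.lt_succ_self ⟨Nat.le_of_succ_le hsJ, u', hu', g', hg', h⟩, u, hu, g, hg, hug⟩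

/-- The first column of the minimal circuit that the invasion of `y` reaches is over `z`. -/
def FirstColumn (n : ℕ) (y : Vertex k) (z : ℤ × ℤ) (ω : Config k) : Prop :=
  ∃ (v : Vertex k) (w : (slab k).Walk v v), IsMinOpenCircuit (pc k) ω n (2 * n) w ∧
    ∃ j, (∀ u ∈ (invasion ω y j).verts, ∀ g ∈ w.support, ¬ SameColumn u g) ∧
      (∃ g ∈ w.support, g ∈ column k z) ∧ ∃ u ∈ (invasion ω y (j + 1)).verts, u ∈ column k z

/-- The circuit is unique up to its representation, so `j` is determined as the last stage without a
common column. With distinct labels the next step adds a single edge, whose new vertex determines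
the column. -/
theorem FirstColumn.unique {n : ℕ} {y : Vertex k} {z z' : ℤ × ℤ} {ω : Config k}
    (hinj : Function.Injective ω) (h : FirstColumn n y z ω) (h' : FirstColumn n y z' ω) :
    z = z' := by
  obtain ⟨v, w, hw, j, hj, ⟨g, hg, hgz⟩, u, hu, huz⟩ := h
  obtain ⟨v', w', hw', j', hj', ⟨g', hg', hgz'⟩, u', hu', huz'⟩ := h'
  have hsupp := hw.support_eq hw'
  rw [hsupp] at hj' hg'
  have hug : SameColumn u g := ⟨huz.1.trans hgz.1.symm, huz.2.trans hgz.2.symm⟩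
  have hug' : SameColumn u' g' := ⟨huz'.1.trans hgz'.1.symm, huz'.2.trans hgz'.2.symm⟩
  have hjj : j = j' := by
    rcases lt_trichotomy j j' with hlt | heq | hlt
    · exact absurd hug (hj' u ((invasion_mono ω y hlt).1 hu) g hg)
    · exact heq
    · exact absurd hug' (hj u' ((invasion_mono ω y hlt).1 hu') g' hg')
  subst hjj
  have hnu : u ∉ (invasion ω y j).verts := fun h => hj u h g hg hug
  have hnu' : u' ∉ (invasion ω y j).verts := fun h => hj u' h g' hg' hug'
  obtain ⟨c, hc, e, he, hce⟩ := exists_of_mem_invasionStep hu hnu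
  obtain ⟨c', hc', e', he', hce'⟩ := exists_of_mem_invasionStep hu' hnu'
  have hee : e = e' := hinj (le_antisymm (he.2 e' he'.1) (he'.2 e he.1))
  subst hee
  have hmem : u ∈ s(c', u') := hce' ▸ hce ▸ Sym2.mem_mk_right c u
  rcases Sym2.mem_iff.1 hmem with rfl | rfl
  · exact absurd hc' hnu
  · exact Prod.ext (huz.1.symm.trans huz'.1) (huz.2.symm.trans huz'.2)

/-! ### Measurability -/

/-- Makes quantifiers over circuits countable, so that measurability passes through them. -/
instance (u v : Vertex k) : Countable ((slab k).Walk u v) :=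
  Function.Injective.countable (f := fun w : (slab k).Walk u v => w.support)
    fun _ _ h => SimpleGraph.Walk.ext_support h

theorem measurable_isOpenEdge (p : ℝ) (e : Edge k) :
    Measurable fun ω : Config k => IsOpenEdge p ω e :=
  measurableSet_setOfPred.1
    (measurableSet_lt (measurable_subtype_coe.comp (measurable_pi_apply e)) measurable_const)

theorem measurable_isOpenCircuit (p : ℝ) (a b : ℕ) {v : Vertex k} (w : (slab k).Walk v v) :
    Measurable fun ω : Config k => IsOpenCircuit p ω a b w := by
  have h : (fun ω : Config k => IsOpenCircuit p ω a b w) = fun ω =>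
      (w.IsCycle ∧ (∀ u ∈ w.support, u ∈ box k b \ box k a) ∧ winding w ≠ 0) ∧
        ∀ (e : Sym2 (Vertex k)) (he : e ∈ w.edges),
          IsOpenEdge p ω ⟨e, w.edges_subset_edgeSet he⟩ := by
    funext ω
    exact propext ⟨fun h => ⟨⟨h.1, h.2, h.3⟩, h.4⟩, fun h => ⟨h.1.1, h.1.2.1, h.1.2.2, h.2⟩⟩
  rw [h]
  exact measurable_const.and
    (Measurable.forall fun e => Measurable.forall fun he => measurable_isOpenEdge p _)

theorem measurable_isMinOpenCircuit (p : ℝ) (a b : ℕ) {v : Vertex k} (w : (slab k).Walk v v) :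
    Measurable fun ω : Config k => IsMinOpenCircuit p ω a b w :=
  (measurable_isOpenCircuit p a b w).and (measurable_const.and
    (Measurable.forall fun _ => Measurable.forall fun w' =>
      (measurable_isOpenCircuit p a b w').imp (measurable_const.imp measurable_const)))

theorem measurable_mem_invasion (x : Vertex k) (j : ℕ) :
    (∀ u, Measurable fun ω : Config k => u ∈ (invasion ω x j).verts) ∧
      ∀ e, Measurable fun ω : Config k => e ∈ (invasion ω x j).edgeSet := by
  induction j with
  | zero => exact ⟨fun _ => measurable_const, fun e => (measurable_const :
      Measurable fun _ : Config k => e ∈ ((slab k).singletonSubgraph x).edgeSet)⟩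
  | succ j ih =>
    have hfr : ∀ e : Edge k, Measurable fun ω : Config k =>
        e ∈ frontierEdges (invasion ω x j) := fun e =>
      (ih.2 e.1).not.and (Measurable.exists fun u => (ih.1 u).and measurable_const)
    have hlow : ∀ e : Edge k, Measurable fun ω : Config k => IsLowest ω (invasion ω x j) e :=
      fun e => (hfr e).and (Measurable.forall fun f => (hfr f).imp
        (measurableSet_setOfPred.1
          (measurableSet_le (measurable_pi_apply e) (measurable_pi_apply f))))
    refine ⟨fun u => (ih.1 u).or (Measurable.exists fun e => (hlow e).and measurable_const),
      fun e => ?_⟩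
    induction e with
    | _ a b =>
      exact (ih.2 s(a, b)).or (Measurable.exists fun e => (hlow e).and measurable_const)

/-- Needed to sum over the disjoint first-column events; the good events themselves enter only
through outer measure. -/
theorem measurableSet_firstColumn (n : ℕ) (y : Vertex k) (z : ℤ × ℤ) :
    MeasurableSet {ω : Config k | FirstColumn n y z ω} := by
  refine measurableSet_setOfPred.2 ?_
  refine Measurable.exists fun v => Measurable.exists fun w =>
    (measurable_isMinOpenCircuit _ _ _ w).and (Measurable.exists fun j => ?_)
  exact (Measurable.forall fun u => ((measurable_mem_invasion y j).1 u).imp measurable_const).and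
    (measurable_const.and (Measurable.exists fun u =>
      ((measurable_mem_invasion y (j + 1)).1 u).and measurable_const))

/-! ### Gluing along a column -/

/-- The vertical edge at height `i` of the column over `z`. -/
def columnEdge (z : ℤ × ℤ) (i : Fin k) : Edge k :=
  ⟨s((z.1, z.2, i.castSucc), (z.1, z.2, i.succ)), by simp [slab]⟩

theorem mem_column_of_mem_columnEdge {z : ℤ × ℤ} {i : Fin k} {u : Vertex k}
    (h : u ∈ (columnEdge z i).1) : u ∈ column k z := by
  rcases Sym2.mem_iff.1 h with rfl | rfl <;> exact ⟨rfl, rfl⟩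

/-- The graph of the open edges after opening the column edges in `T`. -/
def openedGraph (p : ℝ) (ω : Config k) (z : ℤ × ℤ) (T : Finset (Fin k)) :
    SimpleGraph (Vertex k) :=
  openGraph p ω ⊔ SimpleGraph.fromEdgeSet ((fun i => (columnEdge z i).1) '' T)

theorem openedGraph_univ_reachable (p : ℝ) (ω : Config k) (z : ℤ × ℤ) {u g : Vertex k}
    (hu : u ∈ column k z) (hg : g ∈ column k z) :
    (openedGraph p ω z Finset.univ).Reachable u g := by
  have h : ∀ i : Fin (k + 1), (openedGraph p ω z Finset.univ).Reachable (z.1, z.2, 0)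
      (z.1, z.2, i) := by
    intro i
    induction i using Fin.induction with
    | zero => exact SimpleGraph.Reachable.refl _
    | succ i ih =>
      refine ih.trans (SimpleGraph.Adj.reachable (Or.inr ?_))
      rw [SimpleGraph.fromEdgeSet_adj]
      exact ⟨⟨i, by simp, rfl⟩, (slab k).ne_of_adj (columnEdge z i).2⟩
  obtain ⟨u₁, u₂, u₃⟩ := u
  obtain ⟨g₁, g₂, g₃⟩ := g
  obtain ⟨rfl, rfl⟩ : u₁ = z.1 ∧ u₂ = z.2 := hu
  obtain ⟨rfl, rfl⟩ : g₁ = z.1 ∧ g₂ = z.2 := hg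
  exact (h u₃).symm.trans (h g₃)

/-- Deleting an edge that is not a bridge does not affect connectivity. -/
theorem reachable_deleteEdges_of_not_isBridge {V : Type*} {G : SimpleGraph V} {e : Sym2 V}
    (he : ¬ G.IsBridge e) {u v : V} (h : G.Reachable u v) :
    (G.deleteEdges {e}).Reachable u v := by
  obtain ⟨w⟩ := h
  induction w with
  | nil => exact SimpleGraph.Reachable.refl _
  | @cons a b c hab w ih =>
    refine SimpleGraph.Reachable.trans ?_ ih
    by_cases hs : s(a, b) = e
    · subst hs
      rwa [SimpleGraph.isBridge_iff, not_not] at he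
    · exact SimpleGraph.Adj.reachable (SimpleGraph.deleteEdges_adj.2 ⟨hab, hs⟩)

/-- The support of an open circuit is contained in one open cluster. -/
theorem IsOpenCircuit.mem_cluster {p : ℝ} {ω : Config k} {a b : ℕ} {v : Vertex k}
    {w : (slab k).Walk v v} (hw : IsOpenCircuit p ω a b w) {u g : Vertex k}
    (hu : u ∈ w.support) (hg : g ∈ w.support) : u ∈ cluster p ω g := by
  classical
  have hG : ∀ e ∈ w.edges, e ∈ (openGraph p ω).edgeSet := fun e he =>
    mem_edgeSet_openGraph.2 (hw.isOpen e he)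
  have h : ∀ x ∈ w.support, (openGraph p ω).Reachable v x := fun x hx =>
    ⟨(w.transfer _ hG).takeUntil x (by rwa [SimpleGraph.Walk.support_transfer])⟩
  exact (h g hg).symm.trans (h u hu)

/-- If the stopped invasion of `x` hits the open cluster of a circuit inside of a closed surface,
then it contains the circuit. -/
theorem IsOpenCircuit.toSubgraph_le {p : ℝ} {ω : Config k} (hinj : Function.Injective ω)
    {a b m : ℕ} {v : Vertex k} {w : (slab k).Walk v v} (hw : IsOpenCircuit p ω a b w)
    {F : Set (Edge k)} (hF : IsClosedSurface p ω b m F) {x g : Vertex k} (hx : x ∈ box k m)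
    (hg : g ∈ w.support) (hit : StoppedHits ω x m (cluster p ω g)) :
    w.toSubgraph ≤ stoppedInvasion ω x m := by
  rw [SimpleGraph.Walk.toSubgraph_le_iff hw.isCycle.not_nil]
  intro e he
  obtain ⟨u, hu⟩ : ∃ u, u ∈ e := by
    induction e with
    | _ a b => exact ⟨a, Sym2.mem_mk_left a b⟩
  exact mem_stoppedInvasion_of_stoppedHits (e := ⟨e, w.edges_subset_edgeSet he⟩) hinj hF hx
    (hw.inside g hg).1 hit (hw.isOpen e he) hu
    (hw.mem_cluster (w.mem_support_of_mem_edges he hu) hg)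

/-- Opening suitable edges of one column, namely of the first column of the minimal circuit that
the invasion of `y` reaches, makes the stopped invasion of `y` contain the circuit. -/
theorem exists_gluing {n m : ℕ} (hnm : 2 * n < m) {ω : Config k} {v : Vertex k}
    {w : (slab k).Walk v v} (hw : IsMinOpenCircuit (pc k) ω n (2 * n) w) {F : Set (Edge k)}
    (hF : IsClosedSurface (pc k) ω (2 * n) m F) {y : Vertex k} (hy : y ∈ box k n) :
    ∃ z : ℤ × ℤ, (∀ u ∈ column k z, u ∉ box k n) ∧ ∃ T : Finset (Fin k), ∀ ω' : Config k,
      Function.Injective ω' →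
      (∀ e, e ∉ columnEdge z '' (T : Set (Fin k)) → ω' e = ω e) →
      (∀ i ∈ T, IsOpenEdge (pc k) ω' (columnEdge z i)) →
      IsMinOpenCircuit (pc k) ω' n (2 * n) w ∧ FirstColumn n y z ω' ∧
      IsClosedSurface (pc k) ω' (2 * n) m F ∧ w.toSubgraph ≤ stoppedInvasion ω' y m ∧
      ∀ x ∈ box k n, (∃ u ∈ w.support, u ∈ (stoppedInvasion ω x m).verts) →
        w.toSubgraph ≤ stoppedInvasion ω' x m := by
  classical
  obtain ⟨j, hjd, hj, u₀, hu₀, g, hg, hug⟩ :=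
    hw.1.exists_sameColumn (ω := ω) hnm (by omega) hy
  set z : ℤ × ℤ := (g.1, g.2.1) with hz
  have hgz : g ∈ column k z := ⟨rfl, rfl⟩
  have huz : u₀ ∈ column k z := hug
  have hcol : ∀ u ∈ column k z, u ∈ box k (2 * n) \ box k n := by
    intro u hu
    have := hw.1.inside g hg
    simpa only [Set.mem_sdiff, box, Set.mem_ofPred_eq, hu.1, hu.2, hz] using this
  refine ⟨z, fun u hu => (hcol u hu).2, ?_⟩
  -- The full column always works, so a minimal `T` exists; it is empty if `u₀` and `g` are already
  -- joined by open edges.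
  obtain ⟨T, hT⟩ := exists_minimal_of_wellFoundedLT
    (fun T : Finset (Fin k) => (openedGraph (pc k) ω z T).Reachable u₀ g)
    ⟨Finset.univ, openedGraph_univ_reachable _ ω z huz hgz⟩
  have hTmin : ∀ i ∈ T, ¬ (openedGraph (pc k) ω z (T.erase i)).Reachable u₀ g := fun i hi h =>
    Finset.notMem_erase i T (hT.le_of_le h (Finset.erase_subset i T) hi)
  refine ⟨T, fun ω' hinj hoff hon => ?_⟩
  have hopen : ∀ e, IsOpenEdge (pc k) ω e → IsOpenEdge (pc k) ω' e := by
    intro e he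
    by_cases hm : e ∈ columnEdge z '' (T : Set (Fin k))
    · obtain ⟨i, hi, rfl⟩ := hm
      exact hon i hi
    · rwa [IsOpenEdge, hoff e hm]
  have hopen' : ∀ e, IsOpenEdge (pc k) ω' e →
      IsOpenEdge (pc k) ω e ∨ ∃ i ∈ T, columnEdge z i = e := by
    intro e he
    by_cases hm : e ∈ columnEdge z '' (T : Set (Fin k))
    · exact Or.inr hm
    · rw [IsOpenEdge, hoff e hm] at he
      exact Or.inl he
  have hle : openedGraph (pc k) ω z T ≤ openGraph (pc k) ω' := by
    refine sup_le (fun a b h => ⟨h.1, hopen _ h.2⟩) fun a b h => ?_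
    obtain ⟨⟨i, hi, hie⟩, -⟩ := (SimpleGraph.fromEdgeSet_adj _).1 h
    have := mem_edgeSet_openGraph.2 (hon i hi)
    rwa [show (columnEdge z i).1 = s(a, b) from hie] at this
  have hreach : (openGraph (pc k) ω').Reachable u₀ g := hT.prop.mono hle
  have hnreach : ∀ i ∈ T,
      ¬ ((openGraph (pc k) ω').deleteEdges {(columnEdge z i).1}).Reachable u₀ g := by
    intro i hi h
    refine hTmin i hi (h.mono fun a b hab => ?_)
    obtain ⟨⟨hab, ho⟩, hne⟩ := SimpleGraph.deleteEdges_adj.1 hab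
    rcases hopen' _ ho with h | ⟨i', hi', hie⟩
    · exact Or.inl ⟨hab, h⟩
    · refine Or.inr ((SimpleGraph.fromEdgeSet_adj _).2 ⟨⟨i', ?_, congrArg Subtype.val hie⟩, hab.ne⟩)
      refine Finset.mem_coe.2 (Finset.mem_erase.2 ⟨?_, hi'⟩)
      rintro rfl
      exact hne (congrArg Subtype.val hie).symm
  have hbridge : ∀ i ∈ T, (openGraph (pc k) ω').IsBridge (columnEdge z i).1 := fun i hi => by
    by_contra h
    exact hnreach i hi (reachable_deleteEdges_of_not_isBridge h hreach)
  -- Every open walk from `u₀` to `g` uses each edge of `T`, so all changes happen inside the new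
  -- cluster of `g` and cannot affect an invasion before it hits that cluster.
  have hTO : ∀ i ∈ T, ∀ u ∈ (columnEdge z i).1, u ∈ cluster (pc k) ω' g := by
    intro i hi u hu
    obtain ⟨q⟩ := hreach
    obtain ⟨e, he, heq⟩ := q.exists_mem_edges_of_not_reachable_deleteEdges (hnreach i hi)
    rw [Set.mem_singleton_iff.1 he] at heq
    have : u ∈ q.support := q.mem_support_of_mem_edges heq hu
    exact (SimpleGraph.Walk.reachable (q.dropUntil u this)).symm
  -- A cycle contains no bridge, so no circuit is created; no edge is closed, so none is lost.
  have hcirc : ∀ (v' : Vertex k) (w' : (slab k).Walk v' v'),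
      IsOpenCircuit (pc k) ω' n (2 * n) w' ↔ IsOpenCircuit (pc k) ω n (2 * n) w' := by
    refine fun v' w' => ⟨fun h => ⟨h.1, h.2, h.3, fun e he => ?_⟩,
      fun h => ⟨h.1, h.2, h.3, fun e he => hopen _ (h.4 e he)⟩⟩
    rcases hopen' _ (h.4 e he) with ho | ⟨i, hi, hie⟩
    · exact ho
    · have hG : ∀ e ∈ w'.edges, e ∈ (openGraph (pc k) ω').edgeSet := fun e he =>
        mem_edgeSet_openGraph.2 (h.isOpen e he)
      refine absurd ?_ ((hbridge i hi).notMem_edges_of_isCycle (h.isCycle.transfer hG))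
      rw [SimpleGraph.Walk.edges_transfer, hie]
      exact he
  have hmin : IsMinOpenCircuit (pc k) ω' n (2 * n) w :=
    ⟨(hcirc v w).2 hw.1, hw.2.1, fun v' w' h => hw.2.2 v' w' ((hcirc v' w').1 h)⟩
  have hF' : IsClosedSurface (pc k) ω' (2 * n) m F := by
    refine ⟨fun e he => ?_, hF.inside, hF.blocks⟩
    rw [IsOpenEdge, hoff e]
    · exact hF.isClosed e he
    · rintro ⟨i, -, rfl⟩
      exact (hF.inside _ he).2 fun u hu => (hcol u (mem_column_of_mem_columnEdge hu)).1
  have hin : ∀ x ∈ box k n, x ∈ box k m := fun x hx => box_mono (by omega) hx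
  have hhit : ∀ x, StoppedHits ω x m (cluster (pc k) ω' g) →
      StoppedHits ω' x m (cluster (pc k) ω' g) := by
    refine fun x h => h.congr fun e he => hoff e ?_
    rintro ⟨i, hi, rfl⟩
    obtain ⟨u, hu, hu'⟩ := he
    exact hu' (hTO i hi u hu)
  refine ⟨hmin, ⟨v, w, hmin, j, ?_⟩, hF', ?_, fun x hx ⟨u, hu, hux⟩ => ?_⟩
  · have heq := invasion_congr (ω := ω) (ω' := ω') (x := y) (s := j + 1) (by
      rintro l hl e ⟨u, hu, hue⟩
      refine hoff e ?_
      rintro ⟨i, -, rfl⟩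
      have := mem_column_of_mem_columnEdge hue
      exact hj u ((invasion_mono ω y (Nat.le_of_lt_succ hl)).1 hu) g hg this)
    rw [heq j j.le_succ, heq (j + 1) le_rfl]
    exact ⟨hj, ⟨g, hg, hgz⟩, u₀, hu₀, huz⟩
  · exact hmin.1.toSubgraph_le hinj hF' (hin y hy) hg
      (hhit y ⟨j + 1, hjd, u₀, hu₀, hreach.symm⟩)
  · exact hmin.1.toSubgraph_le hinj hF' (hin x hx) hg
      (hhit x (StoppedHits.of_mem hux (hmin.1.mem_cluster hu hg)))

/-! ### Comparison of probabilities -/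

/-- The good event, intersected with the glued events of all vertices in `X`. -/
def gluedGoodEvent (k n m : ℕ) (A : Set (Config k)) (X : Set (Vertex k)) : Set (Config k) :=
  {ω | ω ∈ goodEvent k n m A ∧ ∀ x ∈ X, ω ∈ gluedEvent k n m x}

/-- The constant of the gluing lemma. -/
noncomputable def glueConst (k : ℕ) : ENNReal := 2 ^ k * (openProb k ^ k)⁻¹

/-- The configurations of `gluedGoodEvent k n m A X` that are glued to the invasion of `y` by
opening the edges in `T` of the column over `z`. -/
def gluableEvent (k n m : ℕ) (A : Set (Config k)) (X : Set (Vertex k)) (y : Vertex k)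
    (z : ℤ × ℤ) (T : Finset (Fin k)) : Set (Config k) :=
  {ω | ∀ ω' : Config k, Function.Injective ω' →
    (∀ e, e ∉ columnEdge z '' (T : Set (Fin k)) → ω' e = ω e) →
    (∀ i ∈ T, IsOpenEdge (pc k) ω' (columnEdge z i)) →
    ω' ∈ gluedGoodEvent k n m A (insert y X) ∧ FirstColumn n y z ω'}

theorem gluedGoodEvent_subset {n m b : ℕ} (hnm : 2 * n < m) (hb : b ≤ n)
    (A : Set (edgesIn (box k b) → unitInterval)) {X : Set (Vertex k)} (hX : X ⊆ box k n)
    {y : Vertex k} (hy : y ∈ box k n) :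
    gluedGoodEvent k n m (cylinderEvent A) X
      ⊆ ⋃ z, ⋃ T, gluableEvent k n m (cylinderEvent A) X y z T := by
  rintro ω ⟨⟨⟨⟨v₀, w₀, hw₀⟩, F, hF⟩, hA⟩, hglued⟩
  obtain ⟨v, w, hw⟩ := hw₀.exists_min
  obtain ⟨z, hz, T, hT⟩ := exists_gluing hnm hw hF hy
  refine Set.mem_iUnion.2 ⟨z, Set.mem_iUnion.2 ⟨T, fun ω' hinj hoff hon => ?_⟩⟩
  obtain ⟨hw', hfirst, hF', hyl, hxl⟩ := hT ω' hinj hoff hon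
  refine ⟨⟨⟨⟨⟨v, w, hw'.1⟩, F, hF'⟩, ?_⟩, fun x hx => ?_⟩, hfirst⟩
  · have : (fun e : edgesIn (box k b) => ω' e.1) = fun e : edgesIn (box k b) => ω e.1 := by
      funext e
      refine hoff e.1 ?_
      rintro ⟨i, -, hie⟩
      have hmem : ((z.1, z.2, i.castSucc) : Vertex k) ∈ (columnEdge z i).1 := Sym2.mem_mk_left _ _
      refine hz _ (mem_column_of_mem_columnEdge hmem) (box_mono hb ?_)
      rw [hie] at hmem
      exact e.2 _ hmem
    change (fun e : edgesIn (box k b) => ω' e.1) ∈ A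
    rw [this]
    exact hA
  · rcases hx with rfl | hx
    · exact ⟨v, w, hw', hyl⟩
    · obtain ⟨v₁, w₁, hw₁, hle⟩ := hglued x hx
      refine ⟨v, w, hw', hxl x (hX hx) ⟨v, w.start_mem_support, hle.1 ?_⟩⟩
      rw [SimpleGraph.Walk.mem_verts_toSubgraph, hw.support_eq hw₁]
      exact w.start_mem_support

/-- Resample the edges of `T` and require that they come out open; ties form a null set. Since `T`
has at most `k` edges, the exponent `k` serves for all `T`. -/
theorem prob_gluableEvent_le (hp : 0 < pc k) (n m : ℕ) (A : Set (Config k)) (X : Set (Vertex k))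
    (y : Vertex k) (z : ℤ × ℤ) (T : Finset (Fin k)) :
    prob k (gluableEvent k n m A X y z T) ≤ (openProb k ^ k)⁻¹ *
      prob k ({ω | FirstColumn n y z ω} ∩ gluedGoodEvent k n m A (insert y X)) := by
  classical
  have h₁ : prob k (gluableEvent k n m A X y z T)
      * prob k {η | ∀ e ∈ T.image (columnEdge z), IsOpenEdge (pc k) η e}
      ≤ prob k ({ω | FirstColumn n y z ω} ∩ gluedGoodEvent k n m A (insert y X)
        ∪ {ω | ¬ Function.Injective ω}) := by
    refine prob_mul_le_of_resample (columnEdge z '' (T : Set (Fin k))) fun ω hω η hη => ?_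
    by_cases hinj : Function.Injective
      (resample (columnEdge z '' (T : Set (Fin k))) (ω, η) : Config k)
    · refine Or.inl ((hω _ hinj (fun e he => resample_of_notMem he) fun i hi => ?_).symm)
      rw [IsOpenEdge, resample_of_mem (Set.mem_image_of_mem _ (Finset.mem_coe.2 hi))]
      exact hη _ (Finset.mem_image_of_mem _ hi)
    · exact Or.inr hinj
  have h₂ := h₁.trans (measure_union_le _ _)
  rw [prob_not_injective, add_zero, prob_forall_isOpenEdge] at h₂
  have hcard : (T.image (columnEdge z)).card ≤ k :=
    Finset.card_image_le.trans ((Finset.card_le_univ T).trans_eq (Fintype.card_fin k))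
  have hpow : openProb k ^ k ≤ openProb k ^ (T.image (columnEdge z)).card :=
    pow_le_pow_right_of_le_one' openProb_le_one hcard
  have h₃ := (mul_le_mul_right hpow _).trans h₂
  rw [mul_comm, ← div_eq_mul_inv]
  exact (ENNReal.le_div_iff_mul_le (Or.inl (pow_ne_zero _ (openProb_ne_zero hp)))
    (Or.inl (ENNReal.pow_ne_top (ne_top_of_le_ne_top ENNReal.one_ne_top openProb_le_one)))).2 h₃

/-- The gluing lemma: the invasion of `y` can be glued to the minimal circuit at a cost that
depends only on `k`, without detaching the invasions that already contain this circuit. -/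
theorem prob_gluedGoodEvent_le (hp : 0 < pc k) {n m b : ℕ} (hnm : 2 * n < m) (hb : b ≤ n)
    (A : Set (edgesIn (box k b) → unitInterval)) {X : Set (Vertex k)} (hX : X ⊆ box k n)
    {y : Vertex k} (hy : y ∈ box k n) :
    prob k (gluedGoodEvent k n m (cylinderEvent A) X)
      ≤ glueConst k * prob k (gluedGoodEvent k n m (cylinderEvent A) (insert y X)) := by
  set G := gluedGoodEvent k n m (cylinderEvent A) (insert y X) with hG
  -- The first-column events are disjoint up to a null set. Restricting the measure to `G` avoids
  -- any measurability of `G`.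
  have hdisj : ∑' z, prob k ({ω | FirstColumn n y z ω} ∩ G) ≤ prob k G := by
    calc ∑' z, prob k ({ω | FirstColumn n y z ω} ∩ G)
        = ∑' z, (prob k).restrict G {ω | FirstColumn n y z ω} := by
          congr 1
          funext z
          rw [Measure.restrict_apply (measurableSet_firstColumn n y z)]
      _ ≤ (prob k).restrict G (⋃ z, {ω | FirstColumn n y z ω}) := by
          refine tsum_meas_le_meas_iUnion_of_disjoint₀ _
            (fun z => (measurableSet_firstColumn n y z).nullMeasurableSet) fun z z' hzz' => ?_
          refine Measure.absolutelyContinuous_of_le Measure.restrict_le_self ?_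
          have hsub : {ω | FirstColumn n y z ω} ∩ {ω | FirstColumn n y z' ω}
              ⊆ {ω : Config k | ¬ Function.Injective ω} := fun ω hω hinj =>
            hzz' (FirstColumn.unique hinj hω.1 hω.2)
          exact measure_mono_null hsub prob_not_injective
      _ ≤ (prob k).restrict G Set.univ := measure_mono (Set.subset_univ _)
      _ = prob k G := Measure.restrict_apply_univ G
  calc prob k (gluedGoodEvent k n m (cylinderEvent A) X)
      ≤ prob k (⋃ z, ⋃ T, gluableEvent k n m (cylinderEvent A) X y z T) :=
        measure_mono (gluedGoodEvent_subset hnm hb A hX hy)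
    _ ≤ ∑' z, ∑ T, prob k (gluableEvent k n m (cylinderEvent A) X y z T) :=
        (measure_iUnion_le _).trans (ENNReal.tsum_le_tsum fun z => measure_iUnion_fintype_le _ _)
    _ ≤ ∑' z, ∑ _T : Finset (Fin k), (openProb k ^ k)⁻¹ *
          prob k ({ω | FirstColumn n y z ω} ∩ G) :=
        ENNReal.tsum_le_tsum fun z => Finset.sum_le_sum fun T _ =>
          prob_gluableEvent_le hp n m _ X y z T
    _ = glueConst k * ∑' z, prob k ({ω | FirstColumn n y z ω} ∩ G) := by
        rw [← ENNReal.tsum_mul_left]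
        congr 1
        funext z
        simp [glueConst, mul_assoc]
    _ ≤ glueConst k * prob k G := by gcongr

theorem glueConst_ne_top (hp : 0 < pc k) : glueConst k ≠ ⊤ :=
  ENNReal.mul_ne_top (by simp) (ENNReal.inv_ne_top.2 (pow_ne_zero _ (openProb_ne_zero hp)))

theorem glueConst_ne_zero (k : ℕ) : glueConst k ≠ 0 :=
  mul_ne_zero (by simp) (ENNReal.inv_ne_zero.2
    (ENNReal.pow_ne_top (ne_top_of_le_ne_top ENNReal.one_ne_top openProb_le_one)))

/-- The events of an open circuit, of a closed surface around it, and an event inside of the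
circuit are at least as likely to occur together as if they were independent. -/
theorem prob_mul_le_goodEvent {n m b : ℕ} (hb : b ≤ n)
    (A : Set (edgesIn (box k b) → unitInterval)) :
    prob k (surfaceEvent k (2 * n) m) * prob k (circuitEvent k n (2 * n)) *
      prob k (cylinderEvent A) ≤ prob k (goodEvent k n m (cylinderEvent A)) := by
  have h₁ : prob k (surfaceEvent k (2 * n) m) * prob k (circuitEvent k n (2 * n))
      ≤ prob k (circuitEvent k n (2 * n) ∩ surfaceEvent k (2 * n) m) := by
    refine prob_mul_le_of_resample (edgesIn (box k (2 * n))) ?_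
    rintro ω ⟨F, hF⟩ η ⟨v, w, hw⟩
    refine ⟨⟨v, w, hw.1, hw.2, hw.3, fun e he => ?_⟩, F, fun e he => ?_, hF.2, hF.3⟩
    · rw [IsOpenEdge, resample_of_mem]
      · exact hw.4 e he
      · exact fun u hu => (hw.inside u (w.mem_support_of_mem_edges he hu)).1
    · rw [IsOpenEdge, resample_of_notMem (hF.inside e he).2]
      exact hF.isClosed e he
  refine (mul_le_mul_left h₁ _).trans ?_
  refine prob_mul_le_of_resample (edgesIn (box k b)) ?_
  rintro ω ⟨⟨v, w, hw⟩, F, hF⟩ η hη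
  refine ⟨⟨⟨v, w, hw.1, hw.2, hw.3, fun e he => ?_⟩, F, fun e he => ?_, hF.2, hF.3⟩, ?_⟩
  · rw [IsOpenEdge, resample_of_notMem]
    · exact hw.4 e he
    · intro hin
      obtain ⟨u, hu⟩ : ∃ u, u ∈ e := by
        induction e with
        | _ a b => exact ⟨a, Sym2.mem_mk_left a b⟩
      exact (hw.inside u (w.mem_support_of_mem_edges he hu)).2 (box_mono hb (hin u hu))
  · rw [IsOpenEdge, resample_of_notMem]
    · exact hF.isClosed e he
    · exact fun hin => (hF.inside e he).2 fun u hu => box_mono (by omega) (hin u hu)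
  · have : (fun e : edgesIn (box k b) => resample (edgesIn (box k b)) (ω, η) e.1)
        = fun e : edgesIn (box k b) => η e.1 := funext fun e => resample_of_mem e.2
    change (fun e : edgesIn (box k b) => resample (edgesIn (box k b)) (ω, η) e.1) ∈ A
    rw [this]
    exact hη

/-- Labels are nonnegative. With `c₀ > 0` this rules out `pc k ≤ 0`, so positivity of `pc k` need
not be proved. -/
theorem circuitEvent_eq_empty (h : pc k ≤ 0) (a b : ℕ) : circuitEvent k a b = ∅ := by
  refine Set.eq_empty_of_forall_notMem ?_
  rintro ω ⟨v, w, hw⟩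
  have he : s(v, w.snd) ∈ w.edges := w.mk_start_snd_mem_edges hw.isCycle.not_nil
  exact absurd ((hw.isOpen _ he).trans_le h) (not_lt.2 (ω _).2.1)

end SlabInvasion

open SlabInvasion in
theorem lemma4p1 (k : ℕ) :
    ∃ C₁ C₂ C₃ c₂ : ℝ, 0 < c₂ ∧
      ∀ c₀ : ℝ, 0 < c₀ → ∃ c₁ : ℝ, 0 < c₁ ∧
        ∀ n m : ℕ → ℕ,
          (∀ i, 2 * n i < m i ∧ m i < n (i + 1)) →
          (∀ i, c₀ ≤ (prob k).real (circuitEvent k (n i) (2 * n i))) →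
          (∀ i, 1 - c₀ / 2 ≤ (prob k).real (surfaceEvent k (2 * n i) (m i))) →
          ∀ (x : Vertex k) (i₀ : ℕ), x ∈ box k (m i₀) →
          ∀ i : ℕ, i₀ < i →
          ∀ A : Set (edgesIn (box k (m (i - 1))) → unitInterval), MeasurableSet A →
            let B₀ := gluedEvent k (n i) (m i) (origin k)
            let Bx := gluedEvent k (n i) (m i) x
            let Y := goodEvent k (n i) (m i) (cylinderEvent A)
            (prob k).real (B₀ᶜ ∩ Bx ∩ Y) ≤ C₁ * (prob k).real (B₀ ∩ Bx ∩ Y) ∧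
            (prob k).real (B₀ ∩ Bxᶜ ∩ Y) ≤ C₂ * (prob k).real (B₀ ∩ Bx ∩ Y) ∧
            (prob k).real (B₀ᶜ ∩ Bxᶜ ∩ Y) ≤ C₃ * (prob k).real (B₀ ∩ Bx ∩ Y) ∧
            c₂ * (prob k).real Y ≤ (prob k).real (B₀ ∩ Bx ∩ Y) ∧
            c₁ * (prob k).real (cylinderEvent A) ≤ c₂ * (prob k).real Y := by
  rcases le_or_gt (pc k) 0 with hp | hp
  · refine ⟨1, 1, 1, 1, one_pos, fun c₀ hc₀ => ⟨1, one_pos, fun n m _ hC => ?_⟩⟩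
    have := hC 0
    rw [circuitEvent_eq_empty hp, measureReal_empty] at this
    exact absurd hc₀ this.not_gt
  obtain ⟨C, hC⟩ : ∃ C, C = (glueConst k * glueConst k).toReal := ⟨_, rfl⟩
  have htop : glueConst k * glueConst k ≠ ⊤ :=
    ENNReal.mul_ne_top (glueConst_ne_top hp) (glueConst_ne_top hp)
  have hCpos : 0 < C := hC ▸ ENNReal.toReal_pos
    (mul_ne_zero (glueConst_ne_zero k) (glueConst_ne_zero k)) htop
  refine ⟨C, C, C, C⁻¹, inv_pos.2 hCpos, fun c₀ hc₀ =>
    ⟨C⁻¹ * (c₀ / 2), mul_pos (inv_pos.2 hCpos) (half_pos hc₀), ?_⟩⟩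
  intro n m hnm hcirc hsurf x i₀ hx i hi A _ B₀ Bx Y
  have hm : Monotone m := monotone_nat_of_le_succ fun l => by
    have := hnm l
    have := hnm (l + 1)
    omega
  have hbn : m (i - 1) ≤ n i := by
    have := (hnm (i - 1)).2
    rw [Nat.sub_add_cancel (by omega)] at this
    exact this.le
  have hxn : x ∈ box k (n i) := box_mono ((hm (by omega)).trans hbn) hx
  have h0n : origin k ∈ box k (n i) := by simp [origin, box]
  have hglue : prob k Y ≤ glueConst k * glueConst k * prob k (B₀ ∩ Bx ∩ Y) := by
    -- Glue the origin first, then `x` while the origin stays glued; hence the square of the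
    -- constant.
    have h₁ := prob_gluedGoodEvent_le hp (hnm i).1 hbn A (Set.empty_subset _) h0n
    have h₂ := prob_gluedGoodEvent_le hp (hnm i).1 hbn A
      (X := insert (origin k) ∅) (Set.insert_subset h0n (Set.empty_subset _)) hxn
    have h₃ : gluedGoodEvent k (n i) (m i) (cylinderEvent A) ∅ = Y := by
      ext ω; simp [gluedGoodEvent, Y]
    have h₄ : gluedGoodEvent k (n i) (m i) (cylinderEvent A) (insert x (insert (origin k) ∅))
        = B₀ ∩ Bx ∩ Y := by
      ext ω
      simp only [gluedGoodEvent, Set.mem_ofPred_eq, Set.mem_insert_iff, Set.mem_empty_iff_false,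
        or_false, forall_eq_or_imp, forall_eq, Set.mem_inter_iff, B₀, Bx, Y]
      tauto
    rw [h₃] at h₁
    rw [h₄] at h₂
    rw [mul_assoc]
    exact h₁.trans (by gcongr)
  have hreal : (prob k).real Y ≤ C * (prob k).real (B₀ ∩ Bx ∩ Y) := by
    rw [measureReal_def, measureReal_def, hC, ← ENNReal.toReal_mul]
    exact ENNReal.toReal_mono (ENNReal.mul_ne_top htop (measure_ne_top _ _)) hglue
  have hsub : ∀ S : Set (Config k),
      (prob k).real (S ∩ Y) ≤ C * (prob k).real (B₀ ∩ Bx ∩ Y) := fun S =>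
    (measureReal_mono Set.inter_subset_right).trans hreal
  refine ⟨hsub _, hsub _, hsub _, (inv_mul_le_iff₀ hCpos).2 hreal, ?_⟩
  rw [mul_assoc]
  refine mul_le_mul_of_nonneg_left ?_ (inv_pos.2 hCpos).le
  have hY := ENNReal.toReal_mono (measure_ne_top _ _) (prob_mul_le_goodEvent (m := m i) hbn A)
  rw [ENNReal.toReal_mul, ENNReal.toReal_mul] at hY
  refine le_trans (mul_le_mul_of_nonneg_right ?_ measureReal_nonneg) hY
  have h₁ : (prob k).real (circuitEvent k (n i) (2 * n i)) ≤ 1 := measureReal_le_one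
  have h₂ := hcirc i
  have h₃ := hsurf i
  -- The product is at least `(1 - c₀ / 2) * c₀`, and `c₀ ≤ 1` since it is bounded by a probability.
  change c₀ / 2 ≤ (prob k).real _ * (prob k).real _
  nlinarith
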